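/- Thompson's group $F$ (increasing piecewise linear homeomorphisms of $[0,1]$ with finitely many breakpoints, all dyadic, and slopes integer powers of $2$) contains $x_0(t)=\frac t2$ on $[0,\frac12]$, $t-\frac14$ on $[\frac12,\frac34]$, $2t-1$ on $[\frac34,1]$, and $x_1(t)=t$ on $[0,\frac12]$, $\frac t2+\frac14$ on $[\frac12,\frac34]$, $t-\frac18$ on $[\frac34,\frac78]$, $2t-1$ on $[\frac78,1]$. For $x\in[0,1]$ let $\Gamma_x$ be the oriented labelled graph whose vertices are the points of the $F$-orbit of $x$, with an arrow labelled $x_i$ from $a$ to $b$ iff $x_i(a)=b$, with base vertex $x$. When $x$ is irrational, label each vertex of $\Gamma_x$ by its binary expansion, an infinite word over $\{0,1\}$; call it black, grey or white if its label begins with $0$, $10$ or $11$ respectively. Let $\sigma$ be the one-sided shift on infinite words. **Theorem.** Each irrational $x\in[0,1]$ can be written in exactly one way as $0.1^n0w$ or $0.0^m1w$ with $n,m\ge 1$ and $w$ an infinite binary word. Moreover, for this $w$: 1. The base vertex of $\Gamma_x$ is labelled by $1^n0w$, respectively $0^m1w$. The labels agree with the standard action on the Cantor set: $x_0$ maps $0v\mapsto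 00v$, $10v\mapsto 01v$, $11v\mapsto 1v$, and $x_1$ maps $0v\mapsto 0v$, $10v\mapsto 100v$, $110v\mapsto 101v$, $111v\mapsto 11v$. 2. $\Gamma_x$, with its base vertex and its labels, is isomorphic to the following graph. Take the infinite binary forest with an infinite upward path of nodes $p_0,p_1,p_2,\dots$, in which every node has exactly one $0$-child (drawn to its lower right) and exactly one $1$-child (drawn to its lower left), $p_{k-1}$ is the $a$-child of $p_k$ where $a$ is the $k$-th letter of $w$ $(k\ge1)$, and every node is a descendant of some $p_k$ (all nodes obtained by different descents being distinct). Each node $u$ carries a word: $p_k$ carries $\sigma^k(w)$, and the $a$-child of a node carrying $s$ carries $as$. A node $u$ carrying $s$ contributes a grey vertex $g_u$ labelled $10s$, black vertices $b_{u,i}$ labelled $0^i1s$ $(i\ge1)$, and white vertices $c_{u,j}$ labelled $1^j0s$ $(j\ge2)$. The arrows are: with label $x_0$, $g_u\to b_{u,1}$, $b_{u,i}\to b_{u,i+1}$, $c_{u,2}\to g_u$, $c_{u,j+1}\to c_{u,j}$; with label $x_1$, a loop at each $b_{u,i}$, $c_{u,j+1}\to c_{u,j}$, an arrow from $g_u$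 to the grey vertex of the $0$-child of $u$, and an arrow from $c_{u,2}$ to the grey vertex of the $1$-child of $u$. The base vertex is the vertex of the node $p_0$ labelled $1^n0w$, respectively $0^m1w$. 3. Say that $z$ hangs from $y$ if $z$ is black and $x_0(y)=z$, or $z$ is white and $x_0(z)=y$, or $z$ is grey and $x_1(y)=z$; the tree hanging down at $y$ is the induced subgraph on $y$ and all vertices obtained from $y$ by iterating this relation. For each grey vertex $y$, with label $10u$, the graph hanging down at $y$ is a tree (orientation, loops and multiplicities of edges being disregarded), and it is canonically isomorphic to the tree hanging down at the vertex labelled $10w$: there is a unique isomorphism of oriented labelled graphs that maps root to root, and for every vertex $z$ it replaces the label $pu$ of $z$ by $pw$, for some finite word $p$. 4. From a grey vertex $v$ one goes up to the left to a grey vertex $v'$ if $x_1(v')=v$, and up to the right if there is a white vertex $z$ with $x_1(z)=v$ and $x_0(z)=v'$. There is a unique infinite path that starts at the vertex labelled $10w$ and goes up in this way at every step. Its $k$-th step goes to the left or to the right iff the $k$-th letter of $w$ is $0$ or $1$ respectively, and after $k$ steps it is at the vertex labelled $10\sigma^k(w)$. 5. $\Gamma_x$ is the limit of Schreier graphs of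 dyadic rational numbers: if $q_1,q_2,\dots\in[0,1]$ are dyadic rationals converging to $x$ (for example, truncations of the binary expansion of $x$), then for every $r$ and all sufficiently large $i$ the balls of radius $r$ around the base vertices of $\Gamma_{q_i}$ and $\Gamma_x$ are isomorphic as pointed oriented labelled graphs. -/

import Mathlib

namespace ThompsonSchreier

/-! ### Thompson's group `F` -/

/-- Dyadic rational numbers. -/
def IsDyadic (r : ℝ) : Prop := ∃ (a : ℤ) (n : ℕ), r = a / 2 ^ n

/-- `f : [0,1] → [0,1]` is piecewise linear, all its breakpoints are among finitely many dyadic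
rationals, and its slopes between breakpoints are integer powers of `2`: on every interval `[a, c]`
whose interior contains none of the breakpoints, `f` is affine with slope `2 ^ k`. -/
def IsDyadicPL (f : unitInterval → unitInterval) : Prop :=
  ∃ D : Finset unitInterval, (∀ d ∈ D, IsDyadic (d : ℝ)) ∧
    ∀ a c : unitInterval, a ≤ c → (∀ d ∈ D, ¬ (a < d ∧ d < c)) →
      ∃ k : ℤ, ∀ s : unitInterval, a ≤ s → s ≤ c →
        (f s : ℝ) = (f a : ℝ) + (2 : ℝ) ^ k * ((s : ℝ) - a)

theorem IsDyadic.add {r s : ℝ} (hr : IsDyadic r) (hs : IsDyadic s) : IsDyadic (r + s) := by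
  obtain ⟨a, n, rfl⟩ := hr
  obtain ⟨b, m, rfl⟩ := hs
  refine ⟨a * 2 ^ m + b * 2 ^ n, n + m, ?_⟩
  push_cast
  rw [pow_add]
  field_simp

theorem IsDyadic.sub {r s : ℝ} (hr : IsDyadic r) (hs : IsDyadic s) : IsDyadic (r - s) := by
  obtain ⟨b, m, rfl⟩ := hs
  rw [sub_eq_add_neg]
  exact hr.add ⟨-b, m, by push_cast; ring⟩

theorem IsDyadic.zpow_mul {r : ℝ} (k : ℤ) (hr : IsDyadic r) : IsDyadic ((2 : ℝ) ^ k * r) := by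
  obtain ⟨a, n, rfl⟩ := hr
  obtain ⟨m, rfl | rfl⟩ := k.eq_nat_or_neg
  · exact ⟨2 ^ m * a, n, by push_cast; rw [zpow_natCast]; ring⟩
  · refine ⟨a, n + m, ?_⟩
    rw [zpow_neg, zpow_natCast, pow_add]
    field_simp

/-- Every point lies on a linear piece that starts at a dyadic point with dyadic value. -/
theorem exists_dyadic_left {f : unitInterval ≃o unitInterval} {D : Finset unitInterval}
    (hD : ∀ d ∈ D, IsDyadic (d : ℝ))
    (h : ∀ a c : unitInterval, a ≤ c → (∀ d ∈ D, ¬ (a < d ∧ d < c)) →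
      ∃ k : ℤ, ∀ s : unitInterval, a ≤ s → s ≤ c →
        (f s : ℝ) = (f a : ℝ) + (2 : ℝ) ^ k * ((s : ℝ) - a)) (t : unitInterval) :
    ∃ (d : unitInterval) (k : ℤ), IsDyadic (d : ℝ) ∧ IsDyadic (f d : ℝ) ∧
      (f t : ℝ) = (f d : ℝ) + (2 : ℝ) ^ k * ((t : ℝ) - d) := by
  suffices H : ∀ (n : ℕ) (t : unitInterval), (D.filter (fun d => d < t)).card = n →
      ∃ (d : unitInterval) (k : ℤ), IsDyadic (d : ℝ) ∧ IsDyadic (f d : ℝ) ∧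
        (f t : ℝ) = (f d : ℝ) + (2 : ℝ) ^ k * ((t : ℝ) - d) from H _ t rfl
  intro n
  induction n using Nat.strong_induction_on with
  | _ n ih =>
    intro t ht
    rcases (D.filter (fun d => d < t)).eq_empty_or_nonempty with he | hne
    · obtain ⟨k, hk⟩ := h ⊥ t bot_le (fun d hd hdt => by
        have : d ∈ D.filter (fun d => d < t) := Finset.mem_filter.2 ⟨hd, hdt.2⟩
        rw [he] at this
        simp at this)
      have h0 : IsDyadic ((⊥ : unitInterval) : ℝ) := ⟨0, 0, by simp⟩
      exact ⟨⊥, k, h0, by rw [f.map_bot]; exact h0, hk t bot_le le_rfl⟩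
    · set e := (D.filter (fun d => d < t)).max' hne with he
      have hmem := Finset.mem_filter.1 ((D.filter (fun d => d < t)).max'_mem hne)
      obtain ⟨k, hk⟩ := h e t hmem.2.le (fun d hd hdt =>
        absurd hdt.1 (not_lt.2 (Finset.le_max' _ d (Finset.mem_filter.2 ⟨hd, hdt.2⟩))))
      have hlt : (D.filter (fun d => d < e)).card < n := by
        rw [← ht]
        apply Finset.card_lt_card
        rw [Finset.ssubset_iff_of_subset]
        · exact ⟨e, Finset.mem_filter.2 hmem, by simp⟩
        · intro d hd
          rw [Finset.mem_filter] at hd ⊢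
          exact ⟨hd.1, hd.2.trans hmem.2⟩
      obtain ⟨d, l, h1, h2, h3⟩ := ih _ hlt e rfl
      have hed : IsDyadic (e : ℝ) := hD e hmem.1
      refine ⟨e, k, hed, ?_, hk t hmem.2.le le_rfl⟩
      rw [h3]
      exact h2.add ((hed.sub h1).zpow_mul l)

theorem IsDyadicPL.isDyadic_apply {f : unitInterval ≃o unitInterval} (hf : IsDyadicPL f)
    (t : unitInterval) : IsDyadic (f t : ℝ) ↔ IsDyadic (t : ℝ) := by
  obtain ⟨D, hD, h⟩ := hf
  obtain ⟨d, k, h1, h2, h3⟩ := exists_dyadic_left hD h t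
  constructor
  · intro ht
    have : (t : ℝ) = d + (2 : ℝ) ^ (-k) * ((f t : ℝ) - f d) := by
      rw [h3, zpow_neg]
      field_simp
      ring
    rw [this]
    exact h1.add ((ht.sub h2).zpow_mul _)
  · intro ht
    rw [h3]
    exact h2.add ((ht.sub h1).zpow_mul _)

/-- Thompson's group `F`: all strictly increasing (piecewise linear) homeomorphisms of `[0,1]` with
finitely many breakpoints, all of them dyadic, and all slopes integer powers of `2`. An order
automorphism of `[0,1]` is the same as a strictly increasing homeomorphism. -/
def thompsonF : Subgroup (unitInterval ≃o unitInterval) where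
  carrier := {f | IsDyadicPL f}
  one_mem' := ⟨∅, by simp, fun a c _ _ => ⟨0, fun s _ _ => by simp⟩⟩
  mul_mem' := by
    classical
    rintro f g hf hg
    have hg' := hg
    obtain ⟨D, hD, h⟩ := hf
    obtain ⟨E, hE, h'⟩ := hg
    refine ⟨E ∪ D.image g.symm, ?_, ?_⟩
    · intro d hd
      rcases Finset.mem_union.1 hd with hd | hd
      · exact hE d hd
      · obtain ⟨e, he, rfl⟩ := Finset.mem_image.1 hd
        rw [← hg'.isDyadic_apply, OrderIso.apply_symm_apply]
        exact hD e he
    · intro a c hac hdis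
      obtain ⟨k, hk⟩ := h' a c hac (fun d hd => hdis d (Finset.mem_union_left _ hd))
      obtain ⟨l, hl⟩ := h (g a) (g c) (g.monotone hac) (fun d hd hlt => by
        refine hdis (g.symm d)
          (Finset.mem_union_right _ (Finset.mem_image_of_mem _ hd)) ⟨?_, ?_⟩
        · rw [OrderIso.lt_symm_apply]; exact hlt.1
        · rw [OrderIso.symm_apply_lt]; exact hlt.2)
      refine ⟨l + k, fun s hs hs' => ?_⟩
      have e1 := hk s hs hs'
      have e2 := hl (g s) (g.monotone hs) (g.monotone hs')
      change (f (g s) : ℝ) = (f (g a) : ℝ) + _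
      rw [e2, e1, zpow_add₀ two_ne_zero]
      ring
  inv_mem' := by
    classical
    rintro f hf
    have hf' := hf
    obtain ⟨D, hD, h⟩ := hf
    refine ⟨D.image f, ?_, ?_⟩
    · intro d hd
      obtain ⟨e, he, rfl⟩ := Finset.mem_image.1 hd
      rw [hf'.isDyadic_apply]
      exact hD e he
    · intro a c hac hdis
      obtain ⟨k, hk⟩ := h (f.symm a) (f.symm c) (f.symm.monotone hac) (fun d hd hlt => by
        refine hdis (f d) (Finset.mem_image_of_mem _ hd) ⟨?_, ?_⟩
        · rw [← OrderIso.symm_apply_lt]; exact hlt.1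
        · rw [← OrderIso.lt_symm_apply]; exact hlt.2)
      refine ⟨-k, fun s hs hs' => ?_⟩
      have e := hk (f.symm s) (f.symm.monotone hs) (f.symm.monotone hs')
      rw [OrderIso.apply_symm_apply, OrderIso.apply_symm_apply] at e
      change (f.symm s : ℝ) = (f.symm a : ℝ) + _
      rw [e, zpow_neg]
      field_simp
      ring

/-- `x₀(t)` -/
noncomputable def x0Fun (t : ℝ) : ℝ :=
  if t ≤ 1 / 2 then t / 2 else if t ≤ 3 / 4 then t - 1 / 4 else 2 * t - 1

/-- `x₁(t)` -/
noncomputable def x1Fun (t : ℝ) : ℝ :=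
  if t ≤ 1 / 2 then t else if t ≤ 3 / 4 then t / 2 + 1 / 4
  else if t ≤ 7 / 8 then t - 1 / 8 else 2 * t - 1

/-- The inverse of `x₀`. -/
noncomputable def x0Inv (s : ℝ) : ℝ :=
  if s ≤ 1 / 4 then 2 * s else if s ≤ 1 / 2 then s + 1 / 4 else (s + 1) / 2

/-- The inverse of `x₁`. -/
noncomputable def x1Inv (s : ℝ) : ℝ :=
  if s ≤ 1 / 2 then s else if s ≤ 5 / 8 then 2 * s - 1 / 2
  else if s ≤ 3 / 4 then s + 1 / 8 else (s + 1) / 2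

/-- The generator `x₀` as an increasing bijection of `[0,1]`; its values are those of `x0Fun`. -/
noncomputable def x0Iso : unitInterval ≃o unitInterval :=
  StrictMono.orderIsoOfRightInverse
    (fun t => ⟨x0Fun t, by
      obtain ⟨h0, h1⟩ := t.2
      unfold x0Fun; constructor <;> split_ifs <;> linarith⟩)
    (by
      intro a b hab
      have hab : (a : ℝ) < b := hab
      rw [← Subtype.coe_lt_coe]
      simp only [x0Fun]
      split_ifs <;> linarith)
    (fun s => ⟨x0Inv s, by
      obtain ⟨h0, h1⟩ := s.2
      unfold x0Inv; constructor <;> split_ifs <;> linarith⟩)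
    (by
      intro s
      apply Subtype.ext
      simp only [x0Fun, x0Inv]
      split_ifs <;> linarith)

/-- The generator `x₁` as an increasing bijection of `[0,1]`; its values are those of `x1Fun`. -/
noncomputable def x1Iso : unitInterval ≃o unitInterval :=
  StrictMono.orderIsoOfRightInverse
    (fun t => ⟨x1Fun t, by
      obtain ⟨h0, h1⟩ := t.2
      unfold x1Fun; constructor <;> split_ifs <;> linarith⟩)
    (by
      intro a b hab
      have hab : (a : ℝ) < b := hab
      rw [← Subtype.coe_lt_coe]
      simp only [x1Fun]
      split_ifs <;> linarith)
    (fun s => ⟨x1Inv s, by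
      obtain ⟨h0, h1⟩ := s.2
      unfold x1Inv; constructor <;> split_ifs <;> linarith⟩)
    (by
      intro s
      apply Subtype.ext
      simp only [x1Fun, x1Inv]
      split_ifs <;> linarith)

theorem coe_x0Iso (t : unitInterval) : (x0Iso t : ℝ) = x0Fun t := rfl

theorem coe_x1Iso (t : unitInterval) : (x1Iso t : ℝ) = x1Fun t := rfl

theorem x0Iso_mem : x0Iso ∈ thompsonF := by
  classical
  have m1 : (1 / 2 : ℝ) ∈ Set.Icc (0 : ℝ) 1 := by constructor <;> norm_num
  have m2 : (3 / 4 : ℝ) ∈ Set.Icc (0 : ℝ) 1 := by constructor <;> norm_num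
  refine ⟨{⟨1 / 2, m1⟩, ⟨3 / 4, m2⟩}, ?_, ?_⟩
  · intro d hd
    simp only [Finset.mem_insert, Finset.mem_singleton] at hd
    rcases hd with rfl | rfl
    · exact ⟨1, 1, by norm_num⟩
    · exact ⟨3, 2, by norm_num⟩
  · intro a c hac h
    have h1 := h ⟨1 / 2, m1⟩ (by simp)
    have h2 := h ⟨3 / 4, m2⟩ (by simp)
    rw [← Subtype.coe_lt_coe, ← Subtype.coe_lt_coe, not_and_or, not_lt, not_lt] at h1 h2
    simp only at h1 h2
    have hac' : (a : ℝ) ≤ c := hac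
    rcases h1 with h1 | h1
    · rcases h2 with h2 | h2
      · refine ⟨1, fun s hs hs' => ?_⟩
        have hs : (a : ℝ) ≤ s := hs
        rw [coe_x0Iso, coe_x0Iso, zpow_one]
        simp only [x0Fun]
        split_ifs <;> linarith
      · refine ⟨0, fun s hs hs' => ?_⟩
        have hs : (a : ℝ) ≤ s := hs
        have hs' : (s : ℝ) ≤ c := hs'
        rw [coe_x0Iso, coe_x0Iso, zpow_zero]
        simp only [x0Fun]
        split_ifs <;> linarith
    · refine ⟨-1, fun s hs hs' => ?_⟩
      have hs : (a : ℝ) ≤ s := hs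
      have hs' : (s : ℝ) ≤ c := hs'
      rw [coe_x0Iso, coe_x0Iso, zpow_neg_one]
      simp only [x0Fun]
      split_ifs <;> linarith

theorem x1Iso_mem : x1Iso ∈ thompsonF := by
  classical
  have m1 : (1 / 2 : ℝ) ∈ Set.Icc (0 : ℝ) 1 := by constructor <;> norm_num
  have m2 : (3 / 4 : ℝ) ∈ Set.Icc (0 : ℝ) 1 := by constructor <;> norm_num
  have m3 : (7 / 8 : ℝ) ∈ Set.Icc (0 : ℝ) 1 := by constructor <;> norm_num
  refine ⟨{⟨1 / 2, m1⟩, ⟨3 / 4, m2⟩, ⟨7 / 8, m3⟩}, ?_, ?_⟩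
  · intro d hd
    simp only [Finset.mem_insert, Finset.mem_singleton] at hd
    rcases hd with rfl | rfl | rfl
    · exact ⟨1, 1, by norm_num⟩
    · exact ⟨3, 2, by norm_num⟩
    · exact ⟨7, 3, by norm_num⟩
  · intro a c hac h
    have h1 := h ⟨1 / 2, m1⟩ (by simp)
    have h2 := h ⟨3 / 4, m2⟩ (by simp)
    have h3 := h ⟨7 / 8, m3⟩ (by simp)
    rw [← Subtype.coe_lt_coe, ← Subtype.coe_lt_coe, not_and_or, not_lt, not_lt] at h1 h2 h3
    simp only at h1 h2 h3
    have hac' : (a : ℝ) ≤ c := hac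
    have key : (7 / 8 ≤ (a : ℝ)) ∨ (3 / 4 ≤ (a : ℝ) ∧ (c : ℝ) ≤ 7 / 8) ∨
        (1 / 2 ≤ (a : ℝ) ∧ (c : ℝ) ≤ 3 / 4) ∨ (c : ℝ) ≤ 1 / 2 := by tauto
    rcases key with k | ⟨k, k'⟩ | ⟨k, k'⟩ | k
    · refine ⟨1, fun s hs hs' => ?_⟩
      have hs : (a : ℝ) ≤ s := hs
      rw [coe_x1Iso, coe_x1Iso, zpow_one]
      simp only [x1Fun]
      split_ifs <;> linarith
    · refine ⟨0, fun s hs hs' => ?_⟩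
      have hs : (a : ℝ) ≤ s := hs
      have hs' : (s : ℝ) ≤ c := hs'
      rw [coe_x1Iso, coe_x1Iso, zpow_zero]
      simp only [x1Fun]
      split_ifs <;> linarith
    · refine ⟨-1, fun s hs hs' => ?_⟩
      have hs : (a : ℝ) ≤ s := hs
      have hs' : (s : ℝ) ≤ c := hs'
      rw [coe_x1Iso, coe_x1Iso, zpow_neg_one]
      simp only [x1Fun]
      split_ifs <;> linarith
    · refine ⟨0, fun s hs hs' => ?_⟩
      have hs : (a : ℝ) ≤ s := hs
      have hs' : (s : ℝ) ≤ c := hs'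
      rw [coe_x1Iso, coe_x1Iso, zpow_zero]
      simp only [x1Fun]
      split_ifs <;> linarith

/-- The names of the two generators. -/
inductive Gen
  | x0
  | x1

/-- The two generators, as elements of `F`. -/
noncomputable def gen : Gen → thompsonF
  | Gen.x0 => ⟨x0Iso, x0Iso_mem⟩
  | Gen.x1 => ⟨x1Iso, x1Iso_mem⟩

/-! ### Oriented labelled graphs and Schreier graphs -/

/-- An oriented graph whose arrows are labelled by elements of `L`
(loops and parallel arrows with different labels are allowed). -/
structure LabelledGraph (L V : Type*) where
  Arrow : L → V → V → Prop

/-- Isomorphisms of labelled oriented graphs. -/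
structure LabelledGraph.Iso {L V W : Type*} (G : LabelledGraph L V) (H : LabelledGraph L W)
    extends V ≃ W where
  arrow_iff : ∀ (l : L) (a b : V), G.Arrow l a b ↔ H.Arrow l (toEquiv a) (toEquiv b)

/-- The subgraph induced on a set of vertices. -/
def LabelledGraph.induce {L V : Type*} (G : LabelledGraph L V) (s : Set V) :
    LabelledGraph L s where
  Arrow l a b := G.Arrow l a b

/-- The underlying simple graph (orientation, labels, loops and multiplicities are forgotten). -/
def LabelledGraph.underlying {L V : Type*} (G : LabelledGraph L V) : SimpleGraph V :=
  SimpleGraph.fromRel (fun a b => ∃ l, G.Arrow l a b)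

/-- The vertices at (combinatorial) distance at most `r` from `v`. -/
def LabelledGraph.ball {L V : Type*} (G : LabelledGraph L V) (v : V) (r : ℕ) : Set V :=
  {a | G.underlying.edist v a ≤ r}

theorem LabelledGraph.mem_ball_self {L V : Type*} (G : LabelledGraph L V) (v : V) (r : ℕ) :
    v ∈ G.ball v r := by
  simp [LabelledGraph.ball]

/-- The balls of radius `r` of two pointed labelled graphs are isomorphic as pointed labelled
graphs. -/
def BallsIsomorphic {L V W : Type*} (G : LabelledGraph L V) (v : V) (H : LabelledGraph L W)
    (w : W) (r : ℕ) : Prop :=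
  ∃ φ : (G.induce (G.ball v r)).Iso (H.induce (H.ball w r)),
    φ.toEquiv ⟨v, G.mem_ball_self v r⟩ = ⟨w, H.mem_ball_self w r⟩

/-- The orbital Schreier graph of an action on `M`: there is an arrow labelled `l` from `a` to `b`
iff the generator `l` moves `a` to `b`. -/
def schreierGraph {L G : Type*} [Group G] (s : L → G) (M : Type*) [MulAction G M] :
    LabelledGraph L M where
  Arrow l a b := s l • a = b

/-- The vertices of `Γ_x`: the orbit of `x` under Thompson's group `F`. -/
abbrev Orbit (x : unitInterval) : Type := MulAction.orbit thompsonF x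

/-- `Γ_x`, the Schreier graph of the action of `F` on the orbit of `x` with respect to
`{x₀, x₁}`. -/
noncomputable def Γ (x : unitInterval) : LabelledGraph Gen (Orbit x) :=
  schreierGraph gen (Orbit x)

/-- The base vertex of `Γ_x`. -/
def base (x : unitInterval) : Orbit x := ⟨x, MulAction.mem_orbit_self x⟩

/-! ### Binary words -/

/-- Infinite words over `{0,1}`, i.e. points of the Cantor set. The number `0.s` is
`Real.ofDigits s`. -/
abbrev Word : Type := Stream' (Fin 2)

/-- The label of a vertex: its binary expansion. -/
noncomputable def label {x : unitInterval} (y : Orbit x) : Word :=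
  Real.digits ((y : unitInterval) : ℝ) 2

/-- The standard action of the generators on the Cantor set:
`x₀ : 0w ↦ 00w, 10w ↦ 01w, 11w ↦ 1w` and
`x₁ : 0w ↦ 0w, 10w ↦ 100w, 110w ↦ 101w, 111w ↦ 11w`. -/
def cantorAct : Gen → Word → Word
  | Gen.x0, s =>
    if s.get 0 = 0 then [0, 0] ++ₛ s.drop 1
    else if s.get 1 = 0 then [0, 1] ++ₛ s.drop 2
    else [1] ++ₛ s.drop 2
  | Gen.x1, s =>
    if s.get 0 = 0 then s
    else if s.get 1 = 0 then [1, 0, 0] ++ₛ s.drop 2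
    else if s.get 2 = 0 then [1, 0, 1] ++ₛ s.drop 3
    else [1, 1] ++ₛ s.drop 3

/-- Grey vertices are those with a label `10*`. -/
def IsGrey (s : Word) : Prop := s.get 0 = 1 ∧ s.get 1 = 0

/-- Black vertices are those with a label `0*`. -/
def IsBlack (s : Word) : Prop := s.get 0 = 0

/-- White vertices are those with a label `11*`. -/
def IsWhite (s : Word) : Prop := s.get 0 = 1 ∧ s.get 1 = 1

/-- The possible beginnings: `ones n` is `1ⁿ⁺¹0` and `zeros m` is `0ᵐ⁺¹1`. So `ones 0` is `10`, the
beginning of the labels of grey vertices, `ones (n + 1)` belongs to white vertices, and `zeros m` to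
black vertices. -/
inductive Head
  | ones (n : ℕ)
  | zeros (m : ℕ)

/-- The finite word of a beginning. -/
def Head.word : Head → List (Fin 2)
  | Head.ones n => List.replicate (n + 1) 1 ++ [0]
  | Head.zeros m => List.replicate (m + 1) 0 ++ [1]

/-! ### The graph in the figure -/

/-- The graph which is drawn along a binary forest with nodes `N`, in which the node `u` has a
right lower neighbour `child 0 u` and a left lower neighbour `child 1 u`. Each node `u` carries a
grey vertex `(u, ones 0)`, a ray of black vertices `(u, zeros m)` and a ray of white vertices
`(u, ones (n + 1))`. -/
inductive FigureArrow {N : Type} (child : Fin 2 → N → N) : Gen → N × Head → N × Head → Prop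
  /- Black vertices: the arrow `x₀` to the next black vertex, and a loop `x₁`. -/
  | black_x0 (u : N) (m : ℕ) :
      FigureArrow child Gen.x0 (u, Head.zeros m) (u, Head.zeros (m + 1))
  | black_x1 (u : N) (m : ℕ) :
      FigureArrow child Gen.x1 (u, Head.zeros m) (u, Head.zeros m)
  /- The grey vertex: the arrow `x₀` to the first black vertex, and the arrow `x₁` down to the
  right to the grey vertex of the right lower node. -/
  | grey_x0 (u : N) :
      FigureArrow child Gen.x0 (u, Head.ones 0) (u, Head.zeros 0)
  | grey_x1 (u : N) :
      FigureArrow child Gen.x1 (u, Head.ones 0) (child 0 u, Head.ones 0)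
  /- The first white vertex: the arrow `x₀` up to the right to the grey vertex, and the arrow `x₁`
  down to the left to the grey vertex of the left lower node. -/
  | first_white_x0 (u : N) :
      FigureArrow child Gen.x0 (u, Head.ones 1) (u, Head.ones 0)
  | first_white_x1 (u : N) :
      FigureArrow child Gen.x1 (u, Head.ones 1) (child 1 u, Head.ones 0)
  /- The other white vertices: arrows `x₀` and `x₁` to the previous white vertex. -/
  | white_x0 (u : N) (n : ℕ) :
      FigureArrow child Gen.x0 (u, Head.ones (n + 2)) (u, Head.ones (n + 1))
  | white_x1 (u : N) (n : ℕ) :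
      FigureArrow child Gen.x1 (u, Head.ones (n + 2)) (u, Head.ones (n + 1))

/-- The nodes of the figure for the word `w`, which has an infinite path `p₀, p₁, p₂, …` going
upwards: `below v` is the node reached from `p₀` downwards (with `v = []` for `p₀` itself),
`spine k` is `pₖ₊₁`, and `side k v` is reached downwards from the lower neighbour of `pₖ₊₁` that is
different from `pₖ`. Lists of turns are written with the last turn first. -/
inductive SpineNode
  | below (v : List (Fin 2))
  | spine (k : ℕ)
  | side (k : ℕ) (v : List (Fin 2))

/-- The node `pₖ`. -/
def spineNode : ℕ → SpineNode
  | 0 => SpineNode.below []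
  | k + 1 => SpineNode.spine k

/-- Lower neighbours: `pₖ` is the lower neighbour of `pₖ₊₁` given by the letter of `w` with index
`k` (counting from `0`), so that `pₖ₊₁` is to the left above `pₖ` if this letter is `0`, and to the
right above `pₖ` if it is `1`. -/
def spineChild (w : Word) (a : Fin 2) : SpineNode → SpineNode
  | SpineNode.below v => SpineNode.below (a :: v)
  | SpineNode.spine k => if a = w.get k then spineNode k else SpineNode.side k []
  | SpineNode.side k v => SpineNode.side k (a :: v)

/-- The word carried by a node: `σᵏ(w)` at `pₖ`, and each turn downwards puts a letter in front. -/
def SpineNode.word (w : Word) : SpineNode → Word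
  | SpineNode.below v => v ++ₛ w
  | SpineNode.spine k => w.drop (k + 1)
  | SpineNode.side k v => v ++ₛ ([1 - w.get k] ++ₛ w.drop (k + 1))

/-- The graph in the figure, for the word `w`. -/
def figureGraph (w : Word) : LabelledGraph Gen (SpineNode × Head) where
  Arrow := FigureArrow (spineChild w)

/-! ### Hanging trees and the upward path, inside `Γ_x` -/

/-- `z` is attached to `y` from below or from the side, as the figure is drawn: black vertices are
attached by the arrow `x₀` that enters them, white vertices by the arrow `x₀` that leaves them, and
grey vertices by the arrow `x₁` that enters them. -/
def HangsFrom {x : unitInterval} (y z : Orbit x) : Prop :=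
  (IsBlack (label z) ∧ (Γ x).Arrow Gen.x0 y z) ∨
  (IsWhite (label z) ∧ (Γ x).Arrow Gen.x0 z y) ∨
  (IsGrey (label z) ∧ (Γ x).Arrow Gen.x1 y z)

/-- The vertices of the tree hanging down at `y`, including its root `y`. -/
def hanging {x : unitInterval} (y : Orbit x) : Set (Orbit x) :=
  {z | Relation.ReflTransGen HangsFrom y z}

/-- The root of the hanging tree. -/
def hangingRoot {x : unitInterval} (y : Orbit x) : hanging y := ⟨y, Relation.ReflTransGen.refl⟩

/-- The tree hanging down at `y`, as a labelled graph. -/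
noncomputable def hangingTree {x : unitInterval} (y : Orbit x) :
    LabelledGraph Gen (hanging y) :=
  (Γ x).induce (hanging y)

/-- One step up and to the left, from a grey vertex to the grey vertex right above it:
there is an arrow `x₁` going down from `y` to `v`. -/
def UpLeft {x : unitInterval} (v y : Orbit x) : Prop :=
  IsGrey (label v) ∧ IsGrey (label y) ∧ (Γ x).Arrow Gen.x1 y v

/-- One step up and to the right, from a grey vertex to the grey vertex right above it:
there is a white vertex between them with an arrow `x₁` down to `v` and an arrow `x₀` up to `y`. -/
def UpRight {x : unitInterval} (v y : Orbit x) : Prop :=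
  IsGrey (label v) ∧ IsGrey (label y) ∧
    ∃ z : Orbit x, IsWhite (label z) ∧ (Γ x).Arrow Gen.x1 z v ∧ (Γ x).Arrow Gen.x0 z y

end ThompsonSchreier

/-!
The label of a vertex of `Γ_x` is the binary expansion of an irrational number, so it is unique, and
it is not eventually periodic: `p ++ₛ s = q ++ₛ s` forces `p = q` (`append_left_inj`), and
`s.drop m = s.drop n` forces `m = n` (`drop_inj`). On labels, the generators act as on the Cantor
set (`label_gen_smul`), by changing a finite beginning. Near an irrational point an element of `F`
has the form `t ↦ 2ᵏt + b` with `b` dyadic (`eventually_smul_eq`). Hence any two labels of vertices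
have a common tail (`exists_drop_label_eq`). Conversely, the generators alone suffice to replace any
finite beginning of a label by any other (`orbit_point_append`). So the labels of the vertices are
precisely the words which have a common tail with the label of `x`.

A word with both letters has a unique factorization `h.word ++ₛ s` with a beginning `h`
(`head_append_inj`, `exists_head_append`). For a forest whose nodes carry words such that going down
puts a letter in front, the arrows of the figure are exactly the action on the words
`h.word ++ₛ s` (`figureAct_word`). To identify `Γ_x` with the figure, it therefore remains to see that
the words `s` with a tail in common with `w` correspond bijectively to the nodes (`word_injective`,
`exists_word_eq`). The same computation for the binary tree of finite words `v`, carrying `v ++ₛ u`,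
identifies the tree hanging down at `10u` with one fixed graph `modelTree`, for all `u`
(`exists_modelTree_iso`). This graph is a tree because every vertex but the root has exactly one
neighbour of smaller rank (`isTree_of_parent`).

As to the limit, a ball of radius `r` is determined by which equations between products of
generators hold at the base vertex, for finitely many products (`ballsIsomorphic_of_smul_eq_iff`). An
equation that fails at `x` fails nearby by continuity. An equation that holds at `x` says that some
element of `F` fixes `x`; this element is the identity near `x`, since otherwise its fixed point
would be rational (`eventually_smul_eq_self`), and so the equation holds nearby.
-/

namespace ThompsonSchreier

open Filter Topology

/-! ### Binary words and their values -/

theorem ofDigits_cons (a : Fin 2) (s : Word) :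
    Real.ofDigits ([a] ++ₛ s) = ((a : ℕ) + Real.ofDigits s) / 2 := by
  refine (Real.ofDigits_eq_sum_add_ofDigits _ 1).trans ?_
  rw [Finset.sum_range_one]
  change ((a : ℕ) : ℝ) * (((2 : ℕ) : ℝ) ^ (0 + 1))⁻¹ + (((2 : ℕ) : ℝ) ^ 1)⁻¹ * Real.ofDigits s = _
  push_cast
  ring

theorem cons_append (a : Fin 2) (p : List (Fin 2)) (s : Word) :
    (a :: p) ++ₛ s = [a] ++ₛ (p ++ₛ s) := rfl

theorem cons_append_eq_iff {a b : Fin 2} {s t : Word} :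
    [a] ++ₛ s = [b] ++ₛ t ↔ a = b ∧ s = t := by
  constructor
  · intro h
    exact ⟨congrArg (fun u : Word => u.get 0) h, congrArg Stream'.tail h⟩
  · rintro ⟨rfl, rfl⟩
    rfl

theorem get_zero_append_drop (s : Word) : [s.get 0] ++ₛ s.drop 1 = s :=
  Stream'.append_stream_head_tail s

theorem ofDigits_append (p : List (Fin 2)) :
    ∃ c : ℤ, ∀ s : Word, Real.ofDigits (p ++ₛ s) = (c + Real.ofDigits s) / 2 ^ p.length := by
  induction p with
  | nil => exact ⟨0, fun s => by simp⟩
  | cons a p ih =>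
    obtain ⟨c, hc⟩ := ih
    refine ⟨2 ^ p.length * (a : ℕ) + c, fun s => ?_⟩
    rw [cons_append, ofDigits_cons, hc, List.length_cons, pow_succ]
    push_cast
    field_simp
    ring

theorem irrational_ofDigits_append {p : List (Fin 2)} {s : Word} :
    Irrational (Real.ofDigits (p ++ₛ s)) ↔ Irrational (Real.ofDigits s) := by
  obtain ⟨c, hc⟩ := ofDigits_append p
  have h2 : (2 : ℝ) ^ p.length = ((2 ^ p.length : ℚ) : ℝ) := by push_cast; rfl
  rw [hc, h2, irrational_div_ratCast_iff, irrational_intCast_add_iff]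
  simp

theorem irrational_ofDigits_drop {s : Word} (n : ℕ) :
    Irrational (Real.ofDigits (s.drop n)) ↔ Irrational (Real.ofDigits s) := by
  conv_rhs => rw [← Stream'.append_take_drop n s]
  rw [irrational_ofDigits_append]

theorem ofDigits_pos_lt_one {s : Word} (hs : Irrational (Real.ofDigits s)) :
    0 < Real.ofDigits s ∧ Real.ofDigits s < 1 :=
  ⟨lt_of_le_of_ne (Real.ofDigits_nonneg s) hs.ne_zero.symm,
    lt_of_le_of_ne (Real.ofDigits_le_one s) hs.ne_one⟩

/-- An irrational number has only one binary expansion. -/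
theorem ofDigits_inj {s t : Word} (hs : Irrational (Real.ofDigits s)) :
    Real.ofDigits s = Real.ofDigits t ↔ s = t := by
  refine ⟨fun h => Stream'.ext fun n => ?_, fun h => h ▸ rfl⟩
  induction n generalizing s t with
  | zero =>
    have h1 := ofDigits_pos_lt_one ((irrational_ofDigits_drop 1).2 hs)
    have h2 := ofDigits_pos_lt_one ((irrational_ofDigits_drop 1).2 (h ▸ hs))
    rw [← get_zero_append_drop s, ← get_zero_append_drop t, ofDigits_cons, ofDigits_cons] at h
    generalize s.get 0 = a at *
    generalize t.get 0 = b at *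
    fin_cases a <;> fin_cases b <;> norm_num at h ⊢ <;> linarith
  | succ n ih =>
    have h1 := ofDigits_pos_lt_one ((irrational_ofDigits_drop 1).2 hs)
    have h2 := ofDigits_pos_lt_one ((irrational_ofDigits_drop 1).2 (h ▸ hs))
    rw [← get_zero_append_drop s, ← get_zero_append_drop t, ofDigits_cons, ofDigits_cons] at h
    refine ih (s := s.drop 1) (t := t.drop 1) ((irrational_ofDigits_drop 1).2 hs) ?_
    generalize s.get 0 = a at *
    generalize t.get 0 = b at *
    fin_cases a <;> fin_cases b <;> norm_num at h ⊢ <;> linarith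

/-- The word of an irrational number is not purely periodic. -/
theorem eq_nil_of_append_eq_self {p : List (Fin 2)} {s : Word}
    (hs : Irrational (Real.ofDigits s)) (h : p ++ₛ s = s) : p = [] := by
  by_contra hp
  obtain ⟨c, hc⟩ := ofDigits_append p
  have h1 := hc s
  rw [h] at h1
  have hn : p.length ≠ 0 := by simpa using hp
  have h2 : (1 : ℝ) < 2 ^ p.length := one_lt_pow₀ one_lt_two hn
  refine hs ⟨c / (2 ^ p.length - 1), ?_⟩
  push_cast
  rw [div_eq_iff (by linarith)]
  field_simp at h1
  linarith

theorem append_left_inj {p q : List (Fin 2)} {s : Word} (hs : Irrational (Real.ofDigits s)) :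
    p ++ₛ s = q ++ₛ s ↔ p = q := by
  refine ⟨fun h => ?_, fun h => h ▸ rfl⟩
  wlog hpq : p.length ≤ q.length generalizing p q
  · exact (this h.symm (le_of_not_ge hpq)).symm
  rw [← List.take_append_drop p.length q, Stream'.append_append_stream] at h
  have h1 : p = q.take p.length := Stream'.append_left_injective _ _ _ _ h (by simp [hpq])
  rw [← h1, Stream'.append_right_inj] at h
  have h2 := eq_nil_of_append_eq_self hs h.symm
  rw [← List.take_append_drop p.length q, h2, ← h1, List.append_nil]

theorem drop_add_length_append (p : List (Fin 2)) (s : Word) (n : ℕ) :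
    (p ++ₛ s).drop (n + p.length) = s.drop n := by
  rw [add_comm, ← Stream'.drop_drop, Stream'.drop_append_stream]

theorem drop_add_eq_of_drop_eq {s t : Word} {m n : ℕ} (h : s.drop m = t.drop n) (k : ℕ) :
    s.drop (m + k) = t.drop (n + k) := by
  rw [← Stream'.drop_drop, ← Stream'.drop_drop, h]

/-- The word of an irrational number is not eventually periodic. -/
theorem drop_inj {s : Word} (hs : Irrational (Real.ofDigits s)) {m n : ℕ} :
    s.drop m = s.drop n ↔ m = n := by
  refine ⟨fun h => ?_, fun h => h ▸ rfl⟩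
  wlog hmn : m ≤ n generalizing m n
  · exact (this h.symm (le_of_not_ge hmn)).symm
  obtain ⟨k, rfl⟩ := Nat.exists_eq_add_of_le hmn
  have h1 := Stream'.append_take_drop k (s.drop m)
  rw [Stream'.drop_drop, ← h] at h1
  have h2 := congrArg List.length
    (eq_nil_of_append_eq_self ((irrational_ofDigits_drop m).2 hs) h1)
  rw [Stream'.length_take, List.length_nil] at h2
  rw [h2, add_zero]

/-! ### Beginnings of words -/

theorem ones_zero_word (s : Word) : (Head.ones 0).word ++ₛ s = [1, 0] ++ₛ s := rfl

theorem ones_succ_word (n : ℕ) (s : Word) :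
    (Head.ones (n + 1)).word ++ₛ s = [1] ++ₛ ((Head.ones n).word ++ₛ s) := rfl

theorem zeros_zero_word (s : Word) : (Head.zeros 0).word ++ₛ s = [0, 1] ++ₛ s := rfl

theorem zeros_succ_word (n : ℕ) (s : Word) :
    (Head.zeros (n + 1)).word ++ₛ s = [0] ++ₛ ((Head.zeros n).word ++ₛ s) := rfl

/-- A word is determined by, and determines, its beginning together with what follows it. -/
theorem head_append_inj {h k : Head} {s t : Word} :
    h.word ++ₛ s = k.word ++ₛ t ↔ h = k ∧ s = t := by
  refine ⟨fun e => ?_, fun e => e.1 ▸ e.2 ▸ rfl⟩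
  cases h with
  | ones n =>
    cases k with
    | ones m =>
      induction n generalizing m with
      | zero =>
        cases m with
        | zero => simpa [ones_zero_word] using e
        | succ m =>
          have := congrArg (fun u : Word => u.get 1) e
          exact absurd this (by change (0 : Fin 2) ≠ 1; decide)
      | succ n ih =>
        cases m with
        | zero =>
          have := congrArg (fun u : Word => u.get 1) e
          exact absurd this (by change (1 : Fin 2) ≠ 0; decide)
        | succ m =>
          rw [ones_succ_word, ones_succ_word, cons_append_eq_iff] at e
          simpa using ih m e.2
    | zeros m =>
      have := congrArg (fun u : Word => u.get 0) e
      exact absurd this (by change (1 : Fin 2) ≠ 0; decide)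
  | zeros n =>
    cases k with
    | ones m =>
      have := congrArg (fun u : Word => u.get 0) e
      exact absurd this (by change (0 : Fin 2) ≠ 1; decide)
    | zeros m =>
      induction n generalizing m with
      | zero =>
        cases m with
        | zero => simpa [zeros_zero_word] using e
        | succ m =>
          have := congrArg (fun u : Word => u.get 1) e
          exact absurd this (by change (1 : Fin 2) ≠ 0; decide)
      | succ n ih =>
        cases m with
        | zero =>
          have := congrArg (fun u : Word => u.get 1) e
          exact absurd this (by change (0 : Fin 2) ≠ 1; decide)
        | succ m =>
          rw [zeros_succ_word, zeros_succ_word, cons_append_eq_iff] at e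
          simpa using ih m e.2

theorem exists_get_ne {s : Word} (hs : Irrational (Real.ofDigits s)) :
    ∃ n, s.get n ≠ s.get 0 := by
  by_contra! h
  have e : [s.get 0] ++ₛ s = s := by
    refine Stream'.ext fun n => ?_
    cases n with
    | zero => rfl
    | succ n => exact (h n).trans (h (n + 1)).symm
  exact absurd (eq_nil_of_append_eq_self hs e) (by simp)

theorem exists_head_append {s : Word} (hs : Irrational (Real.ofDigits s)) :
    ∃ (h : Head) (t : Word), s = h.word ++ₛ t := by
  obtain ⟨n, hn⟩ := exists_get_ne hs
  induction n generalizing s with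
  | zero => exact absurd rfl hn
  | succ n ih =>
    by_cases h1 : s.get 1 = s.get 0
    · obtain ⟨h, t, e⟩ := ih (s := s.drop 1) ((irrational_ofDigits_drop 1).2 hs)
        (fun h => hn (h.trans h1))
      have e0 : s.get 0 = (h.word ++ₛ t).get 0 := by rw [← e]; exact h1.symm
      cases h with
      | ones m =>
        exact ⟨Head.ones (m + 1), t, by
          rw [ones_succ_word, ← e]; exact (get_zero_append_drop s).symm.trans (by rw [e0]; rfl)⟩
      | zeros m =>
        exact ⟨Head.zeros (m + 1), t, by
          rw [zeros_succ_word, ← e]; exact (get_zero_append_drop s).symm.trans (by rw [e0]; rfl)⟩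
    · have e : s = [s.get 0, s.get 1] ++ₛ s.drop 2 := by
        refine Stream'.ext fun n => ?_
        match n with
        | 0 => rfl
        | 1 => rfl
        | n + 2 => rfl
      have h01 : (s.get 0 = 0 ∧ s.get 1 = 1) ∨ (s.get 0 = 1 ∧ s.get 1 = 0) :=
        (by decide : ∀ a b : Fin 2, b ≠ a → (a = 0 ∧ b = 1) ∨ (a = 1 ∧ b = 0)) _ _ h1
      rcases h01 with ⟨h0, h1⟩ | ⟨h0, h1⟩
      · exact ⟨Head.zeros 0, s.drop 2, by rw [h0, h1] at e; exact e⟩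
      · exact ⟨Head.ones 0, s.drop 2, by rw [h0, h1] at e; exact e⟩

/-! ### The action of the generators on words -/

/-- The two generators as maps of real numbers. -/
noncomputable def genFun : Gen → ℝ → ℝ
  | Gen.x0 => x0Fun
  | Gen.x1 => x1Fun

theorem coe_gen_smul (g : Gen) (t : unitInterval) :
    ((gen g • t : unitInterval) : ℝ) = genFun g t := by
  cases g <;> rfl

theorem cantorAct_x0_zero (t : Word) : cantorAct Gen.x0 ([0] ++ₛ t) = [0] ++ₛ ([0] ++ₛ t) := rfl

theorem cantorAct_x0_one_zero (t : Word) :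
    cantorAct Gen.x0 ([1] ++ₛ ([0] ++ₛ t)) = [0] ++ₛ ([1] ++ₛ t) := rfl

theorem cantorAct_x0_one_one (t : Word) :
    cantorAct Gen.x0 ([1] ++ₛ ([1] ++ₛ t)) = [1] ++ₛ t := rfl

theorem cantorAct_x1_zero (t : Word) : cantorAct Gen.x1 ([0] ++ₛ t) = [0] ++ₛ t := rfl

theorem cantorAct_x1_one_zero (t : Word) :
    cantorAct Gen.x1 ([1] ++ₛ ([0] ++ₛ t)) = [1] ++ₛ ([0] ++ₛ ([0] ++ₛ t)) := rfl

theorem cantorAct_x1_one_one_zero (t : Word) :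
    cantorAct Gen.x1 ([1] ++ₛ ([1] ++ₛ ([0] ++ₛ t))) = [1] ++ₛ ([0] ++ₛ ([1] ++ₛ t)) := rfl

theorem cantorAct_x1_one_one_one (t : Word) :
    cantorAct Gen.x1 ([1] ++ₛ ([1] ++ₛ ([1] ++ₛ t))) = [1] ++ₛ ([1] ++ₛ t) := rfl

theorem exists_eq_zero_or_one (s : Word) : ∃ t, s = [0] ++ₛ t ∨ s = [1] ++ₛ t := by
  refine ⟨s.drop 1, ?_⟩
  have h := get_zero_append_drop s
  generalize s.get 0 = a at h
  fin_cases a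
  · exact Or.inl h.symm
  · exact Or.inr h.symm

/-- The standard action on the Cantor set describes the generators as maps of `[0,1]`. -/
theorem ofDigits_cantorAct (g : Gen) (s : Word) :
    Real.ofDigits (cantorAct g s) = genFun g (Real.ofDigits s) := by
  obtain ⟨t, rfl | rfl⟩ := exists_eq_zero_or_one s
  · have h0 := Real.ofDigits_nonneg t
    have h1 := Real.ofDigits_le_one t
    cases g
    · rw [cantorAct_x0_zero]
      simp only [genFun, x0Fun, ofDigits_cons, Fin.val_zero, Nat.cast_zero]
      split_ifs <;> linarith
    · rw [cantorAct_x1_zero]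
      simp only [genFun, x1Fun, ofDigits_cons, Fin.val_zero, Nat.cast_zero]
      split_ifs <;> linarith
  obtain ⟨t, rfl | rfl⟩ := exists_eq_zero_or_one t
  · have h0 := Real.ofDigits_nonneg t
    have h1 := Real.ofDigits_le_one t
    cases g
    · rw [cantorAct_x0_one_zero]
      simp only [genFun, x0Fun, ofDigits_cons, Fin.val_zero, Fin.val_one, Nat.cast_zero,
        Nat.cast_one]
      split_ifs <;> linarith
    · rw [cantorAct_x1_one_zero]
      simp only [genFun, x1Fun, ofDigits_cons, Fin.val_zero, Fin.val_one, Nat.cast_zero,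
        Nat.cast_one]
      split_ifs <;> linarith
  cases g
  · have h0 := Real.ofDigits_nonneg t
    have h1 := Real.ofDigits_le_one t
    rw [cantorAct_x0_one_one]
    simp only [genFun, x0Fun, ofDigits_cons, Fin.val_one, Nat.cast_one]
    split_ifs <;> linarith
  obtain ⟨t, rfl | rfl⟩ := exists_eq_zero_or_one t
  · have h0 := Real.ofDigits_nonneg t
    have h1 := Real.ofDigits_le_one t
    rw [cantorAct_x1_one_one_zero]
    simp only [genFun, x1Fun, ofDigits_cons, Fin.val_zero, Fin.val_one, Nat.cast_zero,
      Nat.cast_one]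
    split_ifs <;> linarith
  · have h0 := Real.ofDigits_nonneg t
    have h1 := Real.ofDigits_le_one t
    rw [cantorAct_x1_one_one_one]
    simp only [genFun, x1Fun, ofDigits_cons, Fin.val_one, Nat.cast_one]
    split_ifs <;> linarith

/-! ### Orbits of irrational numbers -/

theorem exists_isDyadic_between {l u : ℝ} (h : l < u) : ∃ d, IsDyadic d ∧ l < d ∧ d < u := by
  obtain ⟨n, hn⟩ := exists_pow_lt_of_lt_one (sub_pos.2 h) (one_half_lt_one (α := ℝ))
  have h2 : (0 : ℝ) < 2 ^ n := by positivity
  rw [one_div, inv_pow, inv_lt_iff_one_lt_mul₀' h2] at hn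
  refine ⟨_, ⟨⌊l * 2 ^ n⌋ + 1, n, rfl⟩, ?_, ?_⟩
  · rw [lt_div_iff₀ h2]
    push_cast
    exact Int.lt_floor_add_one _
  · rw [div_lt_iff₀ h2]
    push_cast
    have := Int.floor_le (l * 2 ^ n)
    linarith

/-- An element of `F` is affine near an irrational point, because all its breakpoints are dyadic. -/
theorem eventually_smul_eq (f : thompsonF) {t : unitInterval} (ht : Irrational (t : ℝ)) :
    ∃ (k : ℤ) (b : ℝ), IsDyadic b ∧
      ∀ᶠ s : unitInterval in 𝓝 t, ((f • s : unitInterval) : ℝ) = (2 : ℝ) ^ k * s + b := by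
  obtain ⟨f, hf⟩ := f
  have hf' : IsDyadicPL f := hf
  obtain ⟨D, hD, h⟩ := hf
  have htD : t ∉ D := fun htD => by
    obtain ⟨a, n, e⟩ := hD t htD
    exact ht ⟨a / 2 ^ n, by rw [e]; push_cast; rfl⟩
  have h0 : (0 : unitInterval) < t := lt_of_le_of_ne t.2.1 (fun e => ht.ne_zero (by rw [← e]; rfl))
  have h1 : t < (1 : unitInterval) := lt_of_le_of_ne t.2.2 (fun e => ht.ne_one (by rw [e]; rfl))
  have hU : ((D : Set unitInterval)ᶜ) ∈ 𝓝 t := D.finite_toSet.isClosed.isOpen_compl.mem_nhds htD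
  obtain ⟨l, u, ⟨hl, hu⟩, hlu⟩ := (mem_nhds_iff_exists_Ioo_subset' ⟨0, h0⟩ ⟨1, h1⟩).1 hU
  obtain ⟨a, ha, hla, hat⟩ := exists_isDyadic_between (show (l : ℝ) < t from hl)
  lift a to unitInterval using ⟨l.2.1.trans hla.le, hat.le.trans t.2.2⟩
  have hat' : a < t := hat
  obtain ⟨k, hk⟩ := h a u (hat'.trans hu).le
    (fun d hd hd' => hlu ⟨lt_trans hla hd'.1, hd'.2⟩ hd)
  refine ⟨k, (f a : ℝ) - 2 ^ k * a, ((hf'.isDyadic_apply a).2 ha).sub (ha.zpow_mul k), ?_⟩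
  filter_upwards [Ioo_mem_nhds hat' hu] with s hs
  have := hk s hs.1.le hs.2.le
  change (f s : ℝ) = _
  rw [this]
  ring

theorem irrational_smul (f : thompsonF) {t : unitInterval} (ht : Irrational (t : ℝ)) :
    Irrational ((f • t : unitInterval) : ℝ) := by
  obtain ⟨k, b, ⟨a, n, rfl⟩, h⟩ := eventually_smul_eq f ht
  rw [h.self_of_nhds]
  have e : (2 : ℝ) ^ k = ((2 ^ k : ℚ) : ℝ) := by push_cast; rfl
  have e' : (a : ℝ) / 2 ^ n = ((a / 2 ^ n : ℚ) : ℝ) := by push_cast; rfl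
  rw [e, e', irrational_add_ratCast_iff, irrational_ratCast_mul_iff]
  exact ⟨by positivity, ht⟩

section

variable {x : unitInterval} (hx : Irrational (x : ℝ))

include hx

theorem irrational_orbit (y : Orbit x) : Irrational ((y : unitInterval) : ℝ) := by
  obtain ⟨y, f, rfl⟩ := y
  exact irrational_smul f hx

theorem ofDigits_label (y : Orbit x) : Real.ofDigits (label y) = ((y : unitInterval) : ℝ) :=
  Real.ofDigits_digits one_lt_two
    ⟨y.1.2.1, lt_of_le_of_ne y.1.2.2 (irrational_orbit hx y).ne_one⟩

theorem irrational_ofDigits_label (y : Orbit x) : Irrational (Real.ofDigits (label y)) := by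
  rw [ofDigits_label hx]
  exact irrational_orbit hx y

theorem label_eq_iff {y : Orbit x} {s : Word} :
    label y = s ↔ Real.ofDigits s = ((y : unitInterval) : ℝ) := by
  rw [← ofDigits_label hx, ← ofDigits_inj (irrational_ofDigits_label hx y), eq_comm]

theorem label_inj {y z : Orbit x} : label y = label z ↔ y = z := by
  rw [label_eq_iff hx, ofDigits_label hx, eq_comm]
  exact ⟨fun h => Subtype.ext (Subtype.ext h), fun h => h ▸ rfl⟩

theorem label_gen_smul (g : Gen) (y : Orbit x) : label (gen g • y) = cantorAct g (label y) := by
  rw [label_eq_iff hx, ofDigits_cantorAct, ofDigits_label hx, ← coe_gen_smul]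
  rfl

theorem arrow_iff_label {g : Gen} {y z : Orbit x} :
    (Γ x).Arrow g y z ↔ cantorAct g (label y) = label z := by
  rw [← label_gen_smul hx, label_inj hx]
  rfl

theorem irrational_of_label_eq_append {y : Orbit x} {p : List (Fin 2)} {u : Word}
    (hy : label y = p ++ₛ u) : Irrational (Real.ofDigits u) := by
  rw [← irrational_ofDigits_append (p := p), ← hy]
  exact irrational_ofDigits_label hx y

/-- The labels of two points in an orbit have a common tail: an element of `F` acts on `x` by
`x ↦ 2ᵏx + b` with `b` dyadic, so that for large exponents `2ᴹ(2ᵏx + b)` and `2ᴹ⁺ᵏx` have the same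
fractional part. -/
theorem exists_drop_label_eq (y : Orbit x) :
    ∃ m n, (label y).drop m = (label (base x)).drop n := by
  obtain ⟨y, f, rfl⟩ := y
  set y : Orbit x := ⟨f • x, f, rfl⟩
  obtain ⟨k, b, ⟨a, j, rfl⟩, h⟩ := eventually_smul_eq f hx
  have hy : Real.ofDigits (label y) = (2 : ℝ) ^ k * Real.ofDigits (label (base x)) + a / 2 ^ j := by
    rw [ofDigits_label hx, ofDigits_label hx]
    exact h.self_of_nhds
  obtain ⟨i, n, hk⟩ : ∃ i n : ℕ, (2 : ℝ) ^ k = 2 ^ n / 2 ^ i := by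
    obtain ⟨i, rfl | rfl⟩ := k.eq_nat_or_neg
    · exact ⟨0, i, by simp⟩
    · exact ⟨i, 0, by simp⟩
  refine ⟨i + j, n + j, ?_⟩
  have hiy := irrational_ofDigits_label hx y
  have hix := irrational_ofDigits_label hx (base x)
  rw [← ofDigits_inj ((irrational_ofDigits_drop _).2 hiy)]
  have h1 := ofDigits_pos_lt_one ((irrational_ofDigits_drop (i + j)).2 hiy)
  have h2 := ofDigits_pos_lt_one ((irrational_ofDigits_drop (n + j)).2 hix)
  obtain ⟨c, hc⟩ := ofDigits_append ((label y).take (i + j))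
  obtain ⟨c', hc'⟩ := ofDigits_append ((label (base x)).take (n + j))
  have hc := hc ((label y).drop (i + j))
  have hc' := hc' ((label (base x)).drop (n + j))
  rw [Stream'.append_take_drop, Stream'.length_take] at hc hc'
  rw [hc, hc', hk] at hy
  have e : (c : ℝ) + Real.ofDigits ((label y).drop (i + j)) =
      c' + Real.ofDigits ((label (base x)).drop (n + j)) + a * 2 ^ i := by
    rw [pow_add, pow_add] at hy
    field_simp at hy
    linarith
  have e' : c - c' - a * 2 ^ i = 0 := by
    rw [← Int.abs_lt_one_iff, abs_lt]
    constructor <;> (rify; linarith)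
  have e' : (c : ℝ) - c' - a * 2 ^ i = 0 := by exact_mod_cast e'
  linarith

end

/-- The point of `[0,1]` with a given binary expansion. -/
noncomputable def point (s : Word) : unitInterval :=
  ⟨Real.ofDigits s, Real.ofDigits_nonneg s, Real.ofDigits_le_one s⟩

theorem orbit_point_cantorAct (g : Gen) (s : Word) :
    MulAction.orbit thompsonF (point (cantorAct g s)) = MulAction.orbit thompsonF (point s) := by
  have : point (cantorAct g s) = gen g • point s :=
    Subtype.ext ((ofDigits_cantorAct g s).trans (coe_gen_smul g (point s)).symm)
  rw [this, MulAction.orbit_smul]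

theorem orbit_point_head_append (h : Head) (s : Word) :
    MulAction.orbit thompsonF (point (h.word ++ₛ s)) =
      MulAction.orbit thompsonF (point ([1, 0] ++ₛ s)) := by
  cases h with
  | ones n =>
    induction n with
    | zero => rfl
    | succ n ih =>
      rw [← ih, ← orbit_point_cantorAct Gen.x0]
      rfl
  | zeros n =>
    induction n with
    | zero => exact orbit_point_cantorAct Gen.x0 ([1, 0] ++ₛ s)
    | succ n ih =>
      rw [← ih, ← orbit_point_cantorAct Gen.x0 ((Head.zeros n).word ++ₛ s)]
      rfl

theorem orbit_point_grey_append (p : List (Fin 2)) (s : Word) :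
    MulAction.orbit thompsonF (point ([1, 0] ++ₛ (p ++ₛ s))) =
      MulAction.orbit thompsonF (point ([1, 0] ++ₛ s)) := by
  induction p with
  | nil => rfl
  | cons a p ih =>
    rw [← ih]
    fin_cases a
    · exact orbit_point_cantorAct Gen.x1 ([1, 0] ++ₛ (p ++ₛ s))
    · exact (orbit_point_cantorAct Gen.x1 ((Head.ones 1).word ++ₛ (p ++ₛ s))).trans
        (orbit_point_head_append (Head.ones 1) _)

/-- Changing a finite beginning of the binary expansion does not change the orbit. -/
theorem orbit_point_append (p : List (Fin 2)) {s : Word} (hs : Irrational (Real.ofDigits s)) :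
    MulAction.orbit thompsonF (point (p ++ₛ s)) = MulAction.orbit thompsonF (point s) := by
  have key : ∀ t : Word, Irrational (Real.ofDigits t) →
      MulAction.orbit thompsonF (point t) = MulAction.orbit thompsonF (point ([1, 0] ++ₛ t)) := by
    intro t ht
    obtain ⟨h, t, rfl⟩ := exists_head_append ht
    rw [orbit_point_head_append, orbit_point_grey_append]
  rw [key _ (irrational_ofDigits_append.2 hs), orbit_point_grey_append, ← key _ hs]

theorem exists_label_eq_append {x : unitInterval} (hx : Irrational (x : ℝ)) {y : Orbit x}
    {p : List (Fin 2)} {u : Word} (hy : label y = p ++ₛ u) (q : List (Fin 2)) :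
    ∃ z : Orbit x, label z = q ++ₛ u := by
  have hu := irrational_of_label_eq_append hx hy
  have e : point (p ++ₛ u) = y := Subtype.ext ((label_eq_iff hx).1 hy)
  have hz : point (q ++ₛ u) ∈ MulAction.orbit thompsonF x := by
    rw [← MulAction.orbit_eq_iff.2 y.2, ← e, orbit_point_append p hu, ← orbit_point_append q hu]
    exact MulAction.mem_orbit_self _
  exact ⟨⟨_, hz⟩, (label_eq_iff hx).2 rfl⟩

/-! ### Graphs drawn along forests -/

section

variable {N : Type} {child : Fin 2 → N → N}

/-- The end of the arrow with label `g` that starts at `v`, in a graph drawn along a forest. -/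
def figureAct (child : Fin 2 → N → N) : Gen → N × Head → N × Head
  | Gen.x0, (u, Head.zeros m) => (u, Head.zeros (m + 1))
  | Gen.x1, (u, Head.zeros m) => (u, Head.zeros m)
  | Gen.x0, (u, Head.ones 0) => (u, Head.zeros 0)
  | Gen.x1, (u, Head.ones 0) => (child 0 u, Head.ones 0)
  | Gen.x0, (u, Head.ones (n + 1)) => (u, Head.ones n)
  | Gen.x1, (u, Head.ones 1) => (child 1 u, Head.ones 0)
  | Gen.x1, (u, Head.ones (n + 2)) => (u, Head.ones (n + 1))

theorem figureArrow_iff {g : Gen} {a b : N × Head} :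
    FigureArrow child g a b ↔ figureAct child g a = b := by
  constructor
  · rintro (_ | _ | _ | _ | _ | _ | _ | _) <;> rfl
  · rintro rfl
    obtain ⟨u, n | m⟩ := a
    · match g, n with
      | Gen.x0, 0 => exact .grey_x0 u
      | Gen.x1, 0 => exact .grey_x1 u
      | Gen.x0, 1 => exact .first_white_x0 u
      | Gen.x1, 1 => exact .first_white_x1 u
      | Gen.x0, n + 2 => exact .white_x0 u n
      | Gen.x1, n + 2 => exact .white_x1 u n
    · cases g
      · exact .black_x0 u m
      · exact .black_x1 u m

variable {word : N → Word} (hword : ∀ a u, word (child a u) = [a] ++ₛ word u)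

include hword

theorem figureAct_word (g : Gen) (v : N × Head) :
    (figureAct child g v).2.word ++ₛ word (figureAct child g v).1 =
      cantorAct g (v.2.word ++ₛ word v.1) := by
  obtain ⟨u, n | m⟩ := v
  · match g, n with
    | Gen.x0, 0 => rfl
    | Gen.x1, 0 =>
      change (Head.ones 0).word ++ₛ word (child 0 u) = _
      rw [hword]
      rfl
    | Gen.x0, 1 => rfl
    | Gen.x1, 1 =>
      change (Head.ones 0).word ++ₛ word (child 1 u) = _
      rw [hword]
      rfl
    | Gen.x0, n + 2 => rfl
    | Gen.x1, n + 2 => cases n <;> rfl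
  · cases g <;> rfl

theorem figureArrow_iff_arrow (hinj : Function.Injective word) {x : unitInterval}
    (hx : Irrational (x : ℝ)) {f : N × Head → Orbit x}
    (hf : ∀ v, label (f v) = v.2.word ++ₛ word v.1) {g : Gen} {a b : N × Head} :
    FigureArrow child g a b ↔ (Γ x).Arrow g (f a) (f b) := by
  rw [arrow_iff_label hx, hf, hf, ← figureAct_word hword, figureArrow_iff, head_append_inj,
    hinj.eq_iff, Prod.ext_iff, and_comm]

end

theorem injective_of_label {N : Type} {word : N → Word} (hinj : Function.Injective word)
    {x : unitInterval} {f : N × Head → Orbit x}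
    (hf : ∀ v, label (f v) = v.2.word ++ₛ word v.1) : Function.Injective f := by
  intro a b h
  have h := congrArg label h
  rw [hf, hf, head_append_inj, hinj.eq_iff] at h
  exact Prod.ext h.2 h.1

/-! ### The nodes of the figure -/

theorem word_spineNode (w : Word) (k : ℕ) : (spineNode k).word w = w.drop k := by
  cases k <;> rfl

theorem word_spineChild (w : Word) (a : Fin 2) (u : SpineNode) :
    (spineChild w a u).word w = [a] ++ₛ u.word w := by
  cases u with
  | below v => rfl
  | spine k =>
    by_cases h : a = w.get k
    · rw [spineChild, if_pos h, word_spineNode, h]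
      refine (get_zero_append_drop (w.drop k)).symm.trans ?_
      rw [Stream'.get_drop, Stream'.drop_drop]
      rfl
    · rw [spineChild, if_neg h]
      have : a = 1 - w.get k := (by decide : ∀ a b : Fin 2, a ≠ b → a = 1 - b) _ _ h
      rw [this]
      rfl
  | side k v => rfl

/-- The number of letters that the word of a node has in front of a tail of `w`, and the number of
letters of `w` in front of this tail. -/
def SpineNode.shift : SpineNode → ℕ × ℕ
  | SpineNode.below v => (v.length, 0)
  | SpineNode.spine k => (0, k + 1)
  | SpineNode.side k v => (v.length + 1, k + 1)

theorem drop_shift (w : Word) (u : SpineNode) :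
    (u.word w).drop u.shift.1 = w.drop u.shift.2 := by
  cases u with
  | below v => exact Stream'.drop_append_stream v w
  | spine k => rfl
  | side k v =>
    change (v ++ₛ ([1 - w.get k] ++ₛ w.drop (k + 1))).drop (v.length + 1) = w.drop (k + 1)
    rw [← Stream'.drop_drop, Stream'.drop_append_stream]
    rfl

theorem exists_word_eq_append (w : Word) (u : SpineNode) :
    ∃ (p : List (Fin 2)) (k : ℕ), u.word w = p ++ₛ w.drop k :=
  ⟨(u.word w).take u.shift.1, u.shift.2, by rw [← drop_shift, Stream'.append_take_drop]⟩

theorem exists_word_eq {s w : Word} {m n : ℕ} (h : s.drop m = w.drop n) :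
    ∃ u : SpineNode, u.word w = s := by
  induction m generalizing s with
  | zero => exact ⟨spineNode n, (word_spineNode w n).trans h.symm⟩
  | succ m ih =>
    obtain ⟨u, hu⟩ := ih (s := s.drop 1) (by rw [Stream'.drop_drop, add_comm, h])
    exact ⟨spineChild w (s.get 0) u, by rw [word_spineChild, hu, get_zero_append_drop]⟩

theorem get_word_side (w : Word) (k : ℕ) (v : List (Fin 2)) :
    ((SpineNode.side k v).word w).get v.length = 1 - w.get k :=
  Stream'.get_append_length _ _ 

theorem ne_one_sub (a : Fin 2) : a ≠ 1 - a := by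
  revert a; decide

/-- Different nodes carry different words. Since `w` is not eventually periodic, equal words have
equal shifts relative to `w`, and then the letter at which a `side` path leaves the spine
distinguishes the nodes. -/
theorem word_injective {w : Word} (hw : Irrational (Real.ofDigits w)) :
    Function.Injective (SpineNode.word w) := by
  have hshift : ∀ {u u' : SpineNode}, u.word w = u'.word w →
      u.shift.2 + u'.shift.1 = u'.shift.2 + u.shift.1 := by
    intro u u' h
    rw [← drop_inj hw, ← drop_add_eq_of_drop_eq (drop_shift w u),
      ← drop_add_eq_of_drop_eq (drop_shift w u'), h, add_comm]
  have hget : ∀ (u : SpineNode) (i : ℕ),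
      (u.word w).get (u.shift.1 + i) = w.get (u.shift.2 + i) := by
    intro u i
    rw [← Stream'.get_drop, drop_shift, Stream'.get_drop]
  -- a node whose tail starts early enough differs from a `side` node in the letter `1 - w.get k`
  have hside : ∀ (u : SpineNode) (k : ℕ) (v : List (Fin 2)), u.shift.2 ≤ k →
      u.word w ≠ (SpineNode.side k v).word w := by
    intro u k v hk h
    obtain ⟨i, rfl⟩ := Nat.exists_eq_add_of_le hk
    have e : u.shift.2 + (v.length + 1) = u.shift.2 + i + 1 + u.shift.1 := hshift h
    have e' : v.length = u.shift.1 + i := by omega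
    have h1 := get_word_side w (u.shift.2 + i) v
    rw [← h, e', hget] at h1
    exact ne_one_sub _ h1
  intro u u' h
  have e := hshift h
  match u, u' with
  | .below v, .below v' => rw [(append_left_inj hw).1 h]
  | .below v, .spine k => simp only [SpineNode.shift] at e; omega
  | .spine k, .below v => simp only [SpineNode.shift] at e; omega
  | .below v, .side k v' => exact absurd h (hside _ _ _ (Nat.zero_le k))
  | .side k v', .below v => exact absurd h.symm (hside _ _ _ (Nat.zero_le k))
  | .spine k, .spine k' => simp only [SpineNode.shift] at e; rw [show k = k' by omega]
  | .spine k, .side k' v =>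
    exact absurd h (hside _ _ _ (by simp only [SpineNode.shift] at e ⊢; omega))
  | .side k v, .spine k' =>
    exact absurd h.symm (hside _ _ _ (by simp only [SpineNode.shift] at e ⊢; omega))
  | .side k v, .side k' v' =>
    rcases lt_trichotomy k k' with hk | rfl | hk
    · exact absurd h (hside _ _ _ hk)
    · have hw' : Irrational (Real.ofDigits ([1 - w.get k] ++ₛ w.drop (k + 1))) :=
        irrational_ofDigits_append.2 ((irrational_ofDigits_drop _).2 hw)
      rw [(append_left_inj hw').1 h]
    · exact absurd h.symm (hside _ _ _ hk)

theorem exists_figureGraph_iso {x : unitInterval} (hx : Irrational (x : ℝ)) {h : Head} {w : Word}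
    (hb : label (base x) = h.word ++ₛ w) :
    ∃ φ : (figureGraph w).Iso (Γ x), φ.toEquiv (spineNode 0, h) = base x ∧
      ∀ v, label (φ.toEquiv v) = v.2.word ++ₛ v.1.word w := by
  have hw : Irrational (Real.ofDigits w) := irrational_of_label_eq_append hx hb
  have hf : ∀ v : SpineNode × Head, ∃ y : Orbit x, label y = v.2.word ++ₛ v.1.word w := by
    rintro ⟨u, k⟩
    obtain ⟨p, n, hp⟩ := exists_word_eq_append w u
    rw [← Stream'.append_take_drop n w, ← Stream'.append_append_stream] at hb
    obtain ⟨z, hz⟩ := exists_label_eq_append hx hb (k.word ++ p)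
    exact ⟨z, by rw [hz, Stream'.append_append_stream, hp]⟩
  choose f hf using hf
  have hsurj : Function.Surjective f := by
    intro y
    obtain ⟨k, t, hy⟩ := exists_head_append (irrational_ofDigits_label hx y)
    obtain ⟨m, n, hmn⟩ := exists_drop_label_eq hx y
    have hmn := drop_add_eq_of_drop_eq (drop_add_eq_of_drop_eq hmn h.word.length) k.word.length
    rw [hb, hy, drop_add_length_append, add_right_comm, drop_add_length_append] at hmn
    obtain ⟨u, hu⟩ := exists_word_eq hmn
    exact ⟨(u, k), (label_inj hx).1 (by rw [hf, hu, hy])⟩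
  refine ⟨⟨Equiv.ofBijective f ⟨injective_of_label (word_injective hw) hf, hsurj⟩, fun g a b =>
    figureArrow_iff_arrow (word_spineChild w) (word_injective hw) hx hf⟩, ?_, hf⟩
  exact (label_inj hx).1 ((hf _).trans hb.symm)

/-! ### Graphs given by a parent function -/

/-- A graph in which every vertex but the root is joined to its parent, all edges are of this form,
and parents have smaller rank, is a tree: on a cycle, both neighbours of a vertex of maximal rank
would be its parent. -/
theorem isTree_of_parent {V : Type*} {G : SimpleGraph V} (root : V) (parent : V → V) (rank : V → ℕ)
    (hadj : ∀ a, a ≠ root → G.Adj a (parent a))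
    (hrank : ∀ a, a ≠ root → rank (parent a) < rank a)
    (hparent : ∀ a b, G.Adj a b → (a ≠ root ∧ b = parent a) ∨ (b ≠ root ∧ a = parent b)) :
    G.IsTree := by
  classical
  have hreach : ∀ n a, rank a = n → G.Reachable a root := by
    intro n
    induction n using Nat.strong_induction_on with
    | _ n ih =>
      intro a ha
      by_cases h : a = root
      · rw [h]
      · exact (hadj a h).reachable.trans (ih _ (ha ▸ hrank a h) _ rfl)
  have : Nonempty V := ⟨root⟩
  refine ⟨⟨fun a b => (hreach _ a rfl).trans (hreach _ b rfl).symm⟩, ?_⟩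
  intro v c hc
  obtain ⟨m, hm, hmax⟩ := c.support.toFinset.exists_max_image rank
    ⟨v, by simp⟩
  rw [List.mem_toFinset] at hm
  have hc' := hc.rotate hm
  have hnil := hc'.not_nil
  have key : ∀ a, G.Adj m a → a ∈ (c.rotate m hm).support → a = parent m := by
    intro a hma ha
    rcases hparent m a hma with h | h
    · exact h.2
    · have h1 := hrank a h.1
      rw [← h.2] at h1
      have h2 := hmax a (by
        rw [List.mem_toFinset]
        exact (SimpleGraph.Walk.mem_support_rotate_iff _ _ _).1 ha)
      omega
  refine hc'.snd_ne_penultimate ?_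
  rw [key _ ((c.rotate m hm).adj_snd hnil) (SimpleGraph.Walk.getVert_mem_support _ _),
    key _ ((c.rotate m hm).adj_penultimate hnil).symm (SimpleGraph.Walk.getVert_mem_support _ _)]

section

variable {L V W U : Type*} {G : LabelledGraph L V} {H : LabelledGraph L W} {K : LabelledGraph L U}

/-- The inverse of an isomorphism of labelled graphs. -/
def LabelledGraph.Iso.symm (φ : G.Iso H) : H.Iso G where
  toEquiv := φ.toEquiv.symm
  arrow_iff l a b := by rw [φ.arrow_iff, Equiv.apply_symm_apply, Equiv.apply_symm_apply]

/-- The composition of isomorphisms of labelled graphs. -/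
def LabelledGraph.Iso.trans (φ : G.Iso H) (ψ : H.Iso K) : G.Iso K where
  toEquiv := φ.toEquiv.trans ψ.toEquiv
  arrow_iff l a b := by rw [φ.arrow_iff, ψ.arrow_iff]; rfl

/-- The isomorphism of underlying simple graphs. -/
def LabelledGraph.Iso.underlying (φ : G.Iso H) : G.underlying ≃g H.underlying where
  toEquiv := φ.toEquiv
  map_rel_iff' := by
    intro a b
    simp only [LabelledGraph.underlying, SimpleGraph.fromRel_adj, φ.arrow_iff, ne_eq,
      EmbeddingLike.apply_eq_iff_eq]

end

/-! ### Hanging trees -/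

/-- The tree hanging down at a grey vertex, as a graph drawn along the binary tree of finite words
(the last letter of a path downwards is written first). -/
def modelTree : LabelledGraph Gen (List (Fin 2) × Head) where
  Arrow := FigureArrow List.cons

/-- The root of the tree. -/
def modelRoot : List (Fin 2) × Head := ([], Head.ones 0)

/-- The vertex from which a vertex hangs (the root is mapped to itself). -/
def modelParent : List (Fin 2) × Head → List (Fin 2) × Head
  | (v, Head.zeros 0) => (v, Head.ones 0)
  | (v, Head.zeros (m + 1)) => (v, Head.zeros m)
  | (v, Head.ones (n + 1)) => (v, Head.ones n)
  | (a :: v, Head.ones 0) => (v, if a = 0 then Head.ones 0 else Head.ones 1)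
  | ([], Head.ones 0) => ([], Head.ones 0)

/-- A rank that decreases from every vertex to its parent; the factor `2` accounts for the white
vertex between a grey vertex and the grey vertex of its left lower neighbour. -/
def modelRank : List (Fin 2) × Head → ℕ
  | (v, Head.zeros m) => 2 * v.length + m + 1
  | (v, Head.ones n) => 2 * v.length + n

theorem modelRank_modelParent {a : List (Fin 2) × Head} (h : a ≠ modelRoot) :
    modelRank (modelParent a) < modelRank a := by
  match a with
  | (v, Head.zeros 0) => simp [modelParent, modelRank]
  | (v, Head.zeros (m + 1)) => simp [modelParent, modelRank]
  | (v, Head.ones (n + 1)) => simp [modelParent, modelRank]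
  | (a :: v, Head.ones 0) =>
    by_cases ha : a = 0 <;> simp [modelParent, modelRank, ha, mul_add]
  | ([], Head.ones 0) => exact absurd rfl h

theorem modelTree_adj_parent {a : List (Fin 2) × Head} (h : a ≠ modelRoot) :
    modelTree.underlying.Adj a (modelParent a) := by
  refine (SimpleGraph.fromRel_adj _ _ _).2
    ⟨fun e => (modelRank_modelParent h).ne (congrArg modelRank e.symm), ?_⟩
  match a with
  | (v, Head.zeros 0) => exact Or.inr ⟨_, .grey_x0 v⟩
  | (v, Head.zeros (m + 1)) => exact Or.inr ⟨_, .black_x0 v m⟩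
  | (v, Head.ones 1) => exact Or.inl ⟨_, .first_white_x0 v⟩
  | (v, Head.ones (n + 2)) => exact Or.inl ⟨_, .white_x0 v n⟩
  | (0 :: v, Head.ones 0) => exact Or.inr ⟨_, .grey_x1 v⟩
  | (1 :: v, Head.ones 0) => exact Or.inr ⟨_, .first_white_x1 v⟩
  | ([], Head.ones 0) => exact absurd rfl h

theorem modelTree_parent_of_arrow {g : Gen} {a b : List (Fin 2) × Head} (hab : a ≠ b)
    (h : modelTree.Arrow g a b) :
    (a ≠ modelRoot ∧ b = modelParent a) ∨ (b ≠ modelRoot ∧ a = modelParent b) := by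
  cases h with
  | black_x0 v m => exact Or.inr ⟨by simp [modelRoot], rfl⟩
  | black_x1 v m => exact absurd rfl hab
  | grey_x0 v => exact Or.inr ⟨by simp [modelRoot], rfl⟩
  | grey_x1 v => exact Or.inr ⟨by simp [modelRoot], rfl⟩
  | first_white_x0 v => exact Or.inl ⟨by simp [modelRoot], rfl⟩
  | first_white_x1 v => exact Or.inr ⟨by simp [modelRoot], rfl⟩
  | white_x0 v n => exact Or.inl ⟨by simp [modelRoot], rfl⟩
  | white_x1 v n => exact Or.inl ⟨by simp [modelRoot], rfl⟩

theorem modelTree_isTree : modelTree.underlying.IsTree := by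
  refine isTree_of_parent modelRoot modelParent modelRank (fun _ => modelTree_adj_parent)
    (fun _ => modelRank_modelParent) fun a b h => ?_
  obtain ⟨hab, ⟨g, h⟩ | ⟨g, h⟩⟩ := (SimpleGraph.fromRel_adj _ _ _).1 h
  · exact modelTree_parent_of_arrow hab h
  · exact (modelTree_parent_of_arrow hab.symm h).symm

theorem IsGrey.exists_eq {s : Word} (h : IsGrey s) : ∃ t, s = [1, 0] ++ₛ t :=
  ⟨s.drop 2, Stream'.ext fun n => by
    match n with
    | 0 => exact h.1
    | 1 => exact h.2
    | n + 2 => rfl⟩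

theorem IsWhite.exists_eq {s : Word} (h : IsWhite s) : ∃ t, s = [1, 1] ++ₛ t :=
  ⟨s.drop 2, Stream'.ext fun n => by
    match n with
    | 0 => exact h.1
    | 1 => exact h.2
    | n + 2 => rfl⟩

theorem isGrey_append (t : Word) : IsGrey ([1, 0] ++ₛ t) := ⟨rfl, rfl⟩

theorem isWhite_append (t : Word) : IsWhite ([1, 1] ++ₛ t) := ⟨rfl, rfl⟩

/-- The tree hanging down at a vertex with label `10u` consists of the vertices whose labels are
obtained by replacing `10` by a beginning and a finite word. -/
theorem exists_modelTree_iso {x : unitInterval} (hx : Irrational (x : ℝ)) {y : Orbit x} {u : Word}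
    (hy : label y = [1, 0] ++ₛ u) :
    ∃ φ : modelTree.Iso (hangingTree y), φ.toEquiv modelRoot = hangingRoot y ∧
      ∀ v, label (φ.toEquiv v).1 = v.2.word ++ₛ (v.1 ++ₛ u) := by
  have hu := irrational_of_label_eq_append hx hy
  have hf : ∀ v : List (Fin 2) × Head, ∃ z : Orbit x, label z = v.2.word ++ₛ (v.1 ++ₛ u) := by
    intro v
    obtain ⟨z, hz⟩ := exists_label_eq_append hx hy (v.2.word ++ v.1)
    exact ⟨z, by rw [hz, Stream'.append_append_stream]⟩
  choose f hf using hf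
  have hinj : Function.Injective fun v : List (Fin 2) => v ++ₛ u :=
    fun _ _ h => (append_left_inj hu).1 h
  have harrow : ∀ {g : Gen} {a b : List (Fin 2) × Head},
      FigureArrow List.cons g a b ↔ (Γ x).Arrow g (f a) (f b) := by
    intro g a b
    exact figureArrow_iff_arrow (word := fun v => v ++ₛ u) (fun _ _ => rfl) hinj hx hf
  have hroot : f modelRoot = y := (label_inj hx).1 ((hf _).trans hy.symm)
  have hstep : ∀ a, a ≠ modelRoot → HangsFrom (f (modelParent a)) (f a) := by
    intro a h
    unfold HangsFrom
    rw [hf a]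
    match a with
    | (v, Head.zeros 0) => exact Or.inl ⟨rfl, harrow.1 (.grey_x0 v)⟩
    | (v, Head.zeros (m + 1)) => exact Or.inl ⟨rfl, harrow.1 (.black_x0 v m)⟩
    | (v, Head.ones 1) => exact Or.inr (Or.inl ⟨⟨rfl, rfl⟩, harrow.1 (.first_white_x0 v)⟩)
    | (v, Head.ones (n + 2)) => exact Or.inr (Or.inl ⟨⟨rfl, rfl⟩, harrow.1 (.white_x0 v n)⟩)
    | (0 :: v, Head.ones 0) => exact Or.inr (Or.inr ⟨⟨rfl, rfl⟩, harrow.1 (.grey_x1 v)⟩)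
    | (1 :: v, Head.ones 0) => exact Or.inr (Or.inr ⟨⟨rfl, rfl⟩, harrow.1 (.first_white_x1 v)⟩)
    | ([], Head.ones 0) => exact absurd rfl h
  have hmem : ∀ n a, modelRank a = n → f a ∈ hanging y := by
    intro n
    induction n using Nat.strong_induction_on with
    | _ n ih =>
      intro a ha
      by_cases h : a = modelRoot
      · rw [h, hroot]
        exact Relation.ReflTransGen.refl
      · exact (ih _ (ha ▸ modelRank_modelParent h) _ rfl).tail (hstep a h)
  have hact : ∀ (g : Gen) a z, (Γ x).Arrow g (f a) z → ∃ b, f b = z := by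
    intro g a z h
    exact ⟨figureAct List.cons g a, (harrow.1 (figureArrow_iff.2 rfl)).symm.trans h⟩
  have hsurj : ∀ z ∈ hanging y, ∃ a, f a = z := by
    intro z hz
    induction hz with
    | refl => exact ⟨modelRoot, hroot⟩
    | tail _ h ih =>
      obtain ⟨a, rfl⟩ := ih
      rcases h with ⟨_, h⟩ | ⟨hz, h⟩ | ⟨_, h⟩
      · exact hact _ _ _ h
      · -- an arrow `x₀` from a white vertex cannot end in a black vertex
        have h' := (arrow_iff_label hx).1 h
        obtain ⟨t, ht⟩ := hz.exists_eq
        rw [ht, hf] at h'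
        obtain ⟨v, n | m⟩ := a
        · refine ⟨(v, Head.ones (n + 1)), smul_left_cancel (gen Gen.x0) (Eq.trans ?_ h.symm)⟩
          exact harrow.1 (figureArrow_iff.2 rfl)
        · have h' := congrArg (fun s : Word => s.get 0) h'
          exact absurd h' (by change (1 : Fin 2) ≠ 0; decide)
      · exact hact _ _ _ h
  have hbij : Function.Bijective
      (fun a => (⟨f a, hmem _ a rfl⟩ : hanging y)) := by
    refine ⟨fun a b h => injective_of_label hinj hf (congrArg Subtype.val h), fun z => ?_⟩
    obtain ⟨a, ha⟩ := hsurj z.1 z.2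
    exact ⟨a, Subtype.ext ha⟩
  exact ⟨⟨Equiv.ofBijective _ hbij, fun _ _ _ => harrow⟩, Subtype.ext hroot, hf⟩

theorem hangingTree_isTree {x : unitInterval} (hx : Irrational (x : ℝ)) {y : Orbit x} {u : Word}
    (hy : label y = [1, 0] ++ₛ u) : (hangingTree y).underlying.IsTree := by
  obtain ⟨φ, -, -⟩ := exists_modelTree_iso hx hy
  exact φ.underlying.isTree_iff.1 modelTree_isTree

/-- An isomorphism of hanging trees is determined by the image of the root, because arrows with a
given label are determined by either end. -/
theorem hangingTree_iso_ext {x : unitInterval} {y y' : Orbit x}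
    {φ ψ : (hangingTree y).Iso (hangingTree y')}
    (h : φ.toEquiv (hangingRoot y) = ψ.toEquiv (hangingRoot y)) : φ = ψ := by
  have key : ∀ z, ∀ hz : z ∈ hanging y, φ.toEquiv ⟨z, hz⟩ = ψ.toEquiv ⟨z, hz⟩ := by
    intro z hz
    induction hz with
    | refl => exact h
    | tail hab hbc ih =>
      rename_i b c
      have ih := congrArg Subtype.val ih
      have hout : ∀ g, (Γ x).Arrow g b c →
          φ.toEquiv ⟨c, hab.tail hbc⟩ = ψ.toEquiv ⟨c, hab.tail hbc⟩ := by
        intro g hg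
        have h1 : gen g • (φ.toEquiv ⟨b, hab⟩).1 = _ :=
          (φ.arrow_iff g ⟨b, hab⟩ ⟨c, hab.tail hbc⟩).1 hg
        have h2 : gen g • (ψ.toEquiv ⟨b, hab⟩).1 = _ :=
          (ψ.arrow_iff g ⟨b, hab⟩ ⟨c, hab.tail hbc⟩).1 hg
        exact Subtype.ext (h1.symm.trans ((congrArg _ ih).trans h2))
      rcases hbc with ⟨_, hg⟩ | ⟨hz, hg⟩ | ⟨_, hg⟩
      · exact hout _ hg
      · have h1 : gen Gen.x0 • _ = (φ.toEquiv ⟨b, hab⟩).1 :=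
          (φ.arrow_iff Gen.x0 ⟨c, hab.tail (.inr (.inl ⟨hz, hg⟩))⟩ ⟨b, hab⟩).1 hg
        have h2 : gen Gen.x0 • _ = (ψ.toEquiv ⟨b, hab⟩).1 :=
          (ψ.arrow_iff Gen.x0 ⟨c, hab.tail (.inr (.inl ⟨hz, hg⟩))⟩ ⟨b, hab⟩).1 hg
        exact Subtype.ext (smul_left_cancel _ (h1.trans (ih.trans h2.symm)))
      · exact hout _ hg
  obtain ⟨e, he⟩ := φ
  obtain ⟨e', he'⟩ := ψ
  have : e = e' := Equiv.ext fun z => key z.1 z.2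
  subst this
  rfl

theorem exists_hangingTree_iso {x : unitInterval} (hx : Irrational (x : ℝ)) {y y' : Orbit x}
    {u u' : Word} (hy : label y = [1, 0] ++ₛ u) (hy' : label y' = [1, 0] ++ₛ u') :
    ∃ ψ : (hangingTree y).Iso (hangingTree y'),
      ψ.toEquiv (hangingRoot y) = hangingRoot y' ∧
      (∀ ψ' : (hangingTree y).Iso (hangingTree y'),
        ψ'.toEquiv (hangingRoot y) = hangingRoot y' → ψ' = ψ) ∧
      ∀ z, ∃ p : List (Fin 2), label z.1 = p ++ₛ u ∧ label (ψ.toEquiv z).1 = p ++ₛ u' := by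
  obtain ⟨φ, hroot, hφ⟩ := exists_modelTree_iso hx hy
  obtain ⟨φ', hroot', hφ'⟩ := exists_modelTree_iso hx hy'
  have h : (φ.symm.trans φ').toEquiv (hangingRoot y) = hangingRoot y' := by
    rw [← hroot, ← hroot']
    exact congrArg φ'.toEquiv (φ.toEquiv.symm_apply_apply _)
  refine ⟨φ.symm.trans φ', h, fun ψ' h' => hangingTree_iso_ext (h'.trans h.symm), fun z => ?_⟩
  obtain ⟨v, rfl⟩ := φ.toEquiv.surjective z
  refine ⟨v.2.word ++ v.1, by rw [hφ, Stream'.append_append_stream], ?_⟩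
  rw [Stream'.append_append_stream, ← hφ']
  exact congrArg (fun a => label (φ'.toEquiv a).1) (φ.toEquiv.symm_apply_apply _)

/-! ### The path upwards -/

section

variable {x : unitInterval} (hx : Irrational (x : ℝ))

include hx

theorem upLeft_iff {v y : Orbit x} {s : Word} (hv : label v = [1, 0] ++ₛ s) :
    UpLeft v y ↔ ∃ t, s = [0] ++ₛ t ∧ label y = [1, 0] ++ₛ t := by
  unfold UpLeft
  rw [arrow_iff_label hx, hv]
  constructor
  · rintro ⟨-, hy, h⟩
    obtain ⟨t, ht⟩ := hy.exists_eq
    rw [ht] at h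
    exact ⟨t, ((Stream'.append_right_inj [1, 0] ([0] ++ₛ t) s).1 h).symm, ht⟩
  · rintro ⟨t, rfl, ht⟩
    rw [ht]
    exact ⟨isGrey_append _, isGrey_append _, rfl⟩

theorem upRight_iff {v y : Orbit x} {s : Word} (hv : label v = [1, 0] ++ₛ s) :
    UpRight v y ↔ ∃ t, s = [1] ++ₛ t ∧ label y = [1, 0] ++ₛ t := by
  unfold UpRight
  rw [hv]
  constructor
  · rintro ⟨-, hy, z, hz, h1, h0⟩
    rw [arrow_iff_label hx] at h1 h0
    obtain ⟨t, ht⟩ := hy.exists_eq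
    obtain ⟨t', ht'⟩ := hz.exists_eq
    rw [ht', ht] at h0
    rw [ht', hv] at h1
    have e : t' = [0] ++ₛ t := (Stream'.append_right_inj [1] _ _).1 h0
    rw [e] at h1
    exact ⟨t, ((Stream'.append_right_inj [1, 0] _ _).1 h1).symm, ht⟩
  · rintro ⟨t, rfl, ht⟩
    obtain ⟨z, hz⟩ := exists_label_eq_append hx ht [1, 1, 0]
    rw [ht]
    refine ⟨isGrey_append _, isGrey_append _, z, ?_, ?_, ?_⟩
    · rw [hz]
      exact isWhite_append ([0] ++ₛ t)
    · rw [arrow_iff_label hx, hz, hv]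
      rfl
    · rw [arrow_iff_label hx, hz, ht]
      rfl

theorem exists_upward_path {v₀ : Orbit x} {w : Word} (hv₀ : label v₀ = [1, 0] ++ₛ w) :
    ∃ P : ℕ → Orbit x, P 0 = v₀ ∧
      (∀ k, label (P k) = [1, 0] ++ₛ w.drop k) ∧
      (∀ k, (UpLeft (P k) (P (k + 1)) ↔ w.get k = 0) ∧
        (UpRight (P k) (P (k + 1)) ↔ w.get k = 1)) ∧
      ∀ Q : ℕ → Orbit x, Q 0 = v₀ →
        (∀ k, UpLeft (Q k) (Q (k + 1)) ∨ UpRight (Q k) (Q (k + 1))) → Q = P := by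
  have hP : ∀ k, ∃ y : Orbit x, label y = [1, 0] ++ₛ w.drop k := by
    intro k
    rw [← Stream'.append_take_drop k w, ← Stream'.append_append_stream] at hv₀
    exact exists_label_eq_append hx hv₀ _
  choose P hP using hP
  have hdrop : ∀ k, w.drop k = [w.get k] ++ₛ w.drop (k + 1) := by
    intro k
    refine (get_zero_append_drop (w.drop k)).symm.trans ?_
    rw [Stream'.get_drop, Stream'.drop_drop]
    rfl
  refine ⟨P, (label_inj hx).1 ((hP 0).trans hv₀.symm), hP, fun k => ⟨?_, ?_⟩, ?_⟩
  · rw [upLeft_iff hx (hP k), hdrop, hP (k + 1)]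
    constructor
    · rintro ⟨t, h, -⟩
      exact (cons_append_eq_iff.1 h).1
    · intro h
      exact ⟨_, by rw [h], rfl⟩
  · rw [upRight_iff hx (hP k), hdrop, hP (k + 1)]
    constructor
    · rintro ⟨t, h, -⟩
      exact (cons_append_eq_iff.1 h).1
    · intro h
      exact ⟨_, by rw [h], rfl⟩
  · intro Q h0 hQ
    have hlabel : ∀ k, label (Q k) = [1, 0] ++ₛ w.drop k := by
      intro k
      induction k with
      | zero => rw [h0, hv₀]; rfl
      | succ k ih =>
        have h := hQ k
        rw [upLeft_iff hx ih, upRight_iff hx ih, hdrop] at h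
        rcases h with ⟨t, e, h⟩ | ⟨t, e, h⟩ <;> rw [h, (cons_append_eq_iff.1 e).2]
    exact funext fun k => (label_inj hx).1 ((hlabel k).trans (hP k).symm)

end

/-! ### Balls in Schreier graphs -/

theorem edist_le_succ_iff {V : Type*} {H : SimpleGraph V} {v a : V} {n : ℕ} :
    H.edist v a ≤ (n + 1 : ℕ) ↔ ∃ b, H.edist v b ≤ n ∧ (H.Adj b a ∨ b = a) := by
  constructor
  · intro h
    rw [SimpleGraph.edist_comm] at h
    obtain ⟨p, hp⟩ := SimpleGraph.exists_walk_of_edist_ne_top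
      (ne_top_of_le_ne_top (ENat.natCast_ne_top _) h)
    rw [← hp, Nat.cast_le] at h
    cases p with
    | nil => exact ⟨_, by simp, Or.inr rfl⟩
    | cons hab p =>
      rw [SimpleGraph.Walk.length_cons] at h
      refine ⟨_, ?_, Or.inl hab.symm⟩
      rw [SimpleGraph.edist_comm]
      exact (SimpleGraph.edist_le p).trans (by exact_mod_cast Nat.le_of_succ_le_succ h)
  · rintro ⟨b, hb, h⟩
    rw [← SimpleGraph.edist_le_one_iff_adj_or_eq] at h
    push_cast
    exact SimpleGraph.edist_triangle.trans (add_le_add hb h)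

section

variable {L G : Type*} [Group G] (s : L → G)

/-- The elements of a group that are products of at most `n` generators and inverses of
generators. -/
def generatedBall : ℕ → Set G
  | 0 => {1}
  | n + 1 => generatedBall n ∪
      ((⋃ l, (s l * ·) '' generatedBall n) ∪ ⋃ l, ((s l)⁻¹ * ·) '' generatedBall n)

theorem finite_generatedBall [Finite L] (n : ℕ) : (generatedBall s n).Finite := by
  induction n with
  | zero => exact Set.finite_singleton 1
  | succ n ih =>
    exact ih.union ((Set.finite_iUnion fun l => ih.image _).union
      (Set.finite_iUnion fun l => ih.image _))

theorem one_mem_generatedBall (n : ℕ) : 1 ∈ generatedBall s n := by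
  induction n with
  | zero => rfl
  | succ n ih => exact Or.inl ih

variable {M : Type*} [MulAction G M]

theorem mem_schreierGraph_ball {v a : M} {n : ℕ} :
    a ∈ (schreierGraph s M).ball v n ↔ ∃ g ∈ generatedBall s n, g • v = a := by
  induction n generalizing a with
  | zero =>
    simp only [LabelledGraph.ball, generatedBall, Set.mem_ofPred_eq, Set.mem_singleton_iff,
      exists_eq_left, one_smul, Nat.cast_zero, nonpos_iff_eq_zero, SimpleGraph.edist_eq_zero_iff]
  | succ n ih =>
    have hb : a ∈ (schreierGraph s M).ball v (n + 1) ↔ ∃ b ∈ (schreierGraph s M).ball v n,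
        ((schreierGraph s M).underlying.Adj b a ∨ b = a) := edist_le_succ_iff
    rw [hb]
    constructor
    · rintro ⟨b, hb, h⟩
      obtain ⟨g, hg, rfl⟩ := ih.1 hb
      rcases h with h | rfl
      · obtain ⟨-, ⟨l, h⟩ | ⟨l, h⟩⟩ := (SimpleGraph.fromRel_adj _ _ _).1 h
        · exact ⟨s l * g, Or.inr (Or.inl (Set.mem_iUnion.2 ⟨l, g, hg, rfl⟩)), by
            rw [mul_smul]; exact h⟩
        · exact ⟨(s l)⁻¹ * g, Or.inr (Or.inr (Set.mem_iUnion.2 ⟨l, g, hg, rfl⟩)), by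
            rw [mul_smul, inv_smul_eq_iff]; exact h.symm⟩
      · exact ⟨g, Or.inl hg, rfl⟩
    · rintro ⟨g, hg | hg | hg, rfl⟩
      · exact ⟨_, ih.2 ⟨g, hg, rfl⟩, Or.inr rfl⟩
      · obtain ⟨l, k, hk, rfl⟩ := Set.mem_iUnion.1 hg
        refine ⟨_, ih.2 ⟨k, hk, rfl⟩, ?_⟩
        by_cases h : k • v = (s l * k) • v
        · exact Or.inr h
        · exact Or.inl ((SimpleGraph.fromRel_adj _ _ _).2 ⟨h, Or.inl ⟨l, (mul_smul _ _ _).symm⟩⟩)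
      · obtain ⟨l, k, hk, rfl⟩ := Set.mem_iUnion.1 hg
        refine ⟨_, ih.2 ⟨k, hk, rfl⟩, ?_⟩
        by_cases h : k • v = ((s l)⁻¹ * k) • v
        · exact Or.inr h
        · refine Or.inl ((SimpleGraph.fromRel_adj _ _ _).2 ⟨h, Or.inr ⟨l, ?_⟩⟩)
          change s l • ((s l)⁻¹ * k) • v = k • v
          rw [mul_smul, smul_inv_smul]

/-- If the short products of generators satisfy the same equations at `v` and at `v'`, then they
identify the balls around `v` and `v'`. -/
theorem ballsIsomorphic_of_smul_eq_iff {M' : Type*} [MulAction G M'] {v : M} {v' : M'} {r : ℕ}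
    (h : ∀ g ∈ generatedBall s r, ∀ k ∈ generatedBall s r, (g • v = k • v ↔ g • v' = k • v'))
    (hs : ∀ g ∈ generatedBall s r, ∀ k ∈ generatedBall s r, ∀ l,
      ((s l * g) • v = k • v ↔ (s l * g) • v' = k • v')) :
    BallsIsomorphic (schreierGraph s M) v (schreierGraph s M') v' r := by
  have hc : ∀ a : (schreierGraph s M).ball v r, ∃ g ∈ generatedBall s r, g • v = a.1 :=
    fun a => (mem_schreierGraph_ball s).1 a.2
  choose c hc hcv using hc
  set f : (schreierGraph s M).ball v r → (schreierGraph s M').ball v' r := fun a =>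
    ⟨c a • v', (mem_schreierGraph_ball s).2 ⟨_, hc a, rfl⟩⟩ with hf
  have hbij : Function.Bijective f := by
    constructor
    · intro a b hab
      have hab : c a • v' = c b • v' := congrArg Subtype.val hab
      rw [← h _ (hc a) _ (hc b), hcv, hcv] at hab
      exact Subtype.ext hab
    · rintro ⟨b, hb⟩
      obtain ⟨g, hg, rfl⟩ := (mem_schreierGraph_ball s).1 hb
      refine ⟨⟨g • v, (mem_schreierGraph_ball s).2 ⟨g, hg, rfl⟩⟩, Subtype.ext ?_⟩
      exact (h _ (hc _) _ hg).1 (hcv _)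
  refine ⟨⟨Equiv.ofBijective f hbij, fun l a b => ?_⟩, Subtype.ext ?_⟩
  · change s l • a.1 = b.1 ↔ s l • c a • v' = c b • v'
    rw [← hcv a, ← hcv b, ← mul_smul, ← mul_smul]
    exact hs _ (hc a) _ (hc b) l
  · have h1 := (h _ (hc ⟨v, (schreierGraph s M).mem_ball_self v r⟩) 1
      (one_mem_generatedBall s r)).1 (by rw [hcv, one_smul])
    rw [one_smul] at h1
    exact h1

end

/-! ### Convergence of Schreier graphs -/

instance : Finite Gen :=
  Finite.of_surjective (fun b : Bool => if b then Gen.x0 else Gen.x1) fun g => by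
    cases g
    · exact ⟨true, rfl⟩
    · exact ⟨false, rfl⟩

/-- An element of `F` that fixes an irrational point is the identity near this point: there it is of
the form `t ↦ 2ᵏt + b`, and `2ᵏ ≠ 1` would make the fixed point rational. -/
theorem eventually_smul_eq_self {f : thompsonF} {x : unitInterval} (hx : Irrational (x : ℝ))
    (h : f • x = x) : ∀ᶠ q in 𝓝 x, f • q = q := by
  obtain ⟨k, b, ⟨a, n, rfl⟩, hf⟩ := eventually_smul_eq f hx
  have h1 := hf.self_of_nhds
  rw [h] at h1
  have hk : (2 : ℝ) ^ k = 1 := by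
    by_contra hk
    refine hx ⟨(a / 2 ^ n) / (1 - 2 ^ k), ?_⟩
    push_cast
    rw [div_eq_iff (sub_ne_zero.2 (Ne.symm hk))]
    linarith
  filter_upwards [hf] with q hq
  rw [hk] at hq h1
  exact Subtype.ext (by linarith)

theorem eventually_smul_eq_smul_iff (g k : thompsonF) {x : unitInterval}
    (hx : Irrational (x : ℝ)) : ∀ᶠ q in 𝓝 x, (g • q = k • q ↔ g • x = k • x) := by
  by_cases h : g • x = k • x
  · have h' : (k⁻¹ * g) • x = x := by rw [mul_smul, h, inv_smul_smul]
    filter_upwards [eventually_smul_eq_self hx h'] with q hq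
    rw [mul_smul, inv_smul_eq_iff] at hq
    exact iff_of_true hq h
  · have hg : Continuous fun q : unitInterval => g • q := g.1.continuous
    have hk : Continuous fun q : unitInterval => k • q := k.1.continuous
    filter_upwards [(isOpen_ne_fun hg hk).mem_nhds h] with q hq
    exact iff_of_false hq h

theorem smul_base_eq_iff (g k : thompsonF) (q : unitInterval) :
    g • base q = k • base q ↔ g • q = k • q := Subtype.ext_iff

theorem eventually_ballsIsomorphic {x : unitInterval} (hx : Irrational (x : ℝ)) (r : ℕ) :
    ∀ᶠ q in 𝓝 x, BallsIsomorphic (Γ q) (base q) (Γ x) (base x) r := by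
  have hW := finite_generatedBall gen r
  have h1 : ∀ᶠ q in 𝓝 x, ∀ g ∈ generatedBall gen r, ∀ k ∈ generatedBall gen r,
      (g • q = k • q ↔ g • x = k • x) :=
    (eventually_all_finite hW).2 fun g _ => (eventually_all_finite hW).2 fun k _ =>
      eventually_smul_eq_smul_iff g k hx
  have h2 : ∀ᶠ q in 𝓝 x, ∀ g ∈ generatedBall gen r, ∀ k ∈ generatedBall gen r, ∀ l,
      ((gen l * g) • q = k • q ↔ (gen l * g) • x = k • x) :=
    (eventually_all_finite hW).2 fun g _ => (eventually_all_finite hW).2 fun k _ =>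
      eventually_all.2 fun l => eventually_smul_eq_smul_iff (gen l * g) k hx
  filter_upwards [h1, h2] with q hq1 hq2
  refine ballsIsomorphic_of_smul_eq_iff gen ?_ ?_
  · intro g hg k hk
    rw [smul_base_eq_iff, smul_base_eq_iff]
    exact hq1 g hg k hk
  · intro g hg k hk l
    rw [smul_base_eq_iff, smul_base_eq_iff]
    exact hq2 g hg k hk l

end ThompsonSchreier

theorem mainTheorem2 (x : unitInterval) (hx : Irrational (x : ℝ)) :
    -- `x` is uniquely of the form `0.1ⁿ0w` or `0.0ᵐ1w` with `n, m ≥ 1`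
    (∃! p : ThompsonSchreier.Head × ThompsonSchreier.Word,
      Real.ofDigits (p.1.word ++ₛ p.2) = (x : ℝ)) ∧
    ∀ (h : ThompsonSchreier.Head) (w : ThompsonSchreier.Word),
      Real.ofDigits (h.word ++ₛ w) = (x : ℝ) →
      -- the base vertex is labelled by `x`
      ThompsonSchreier.label (ThompsonSchreier.base x) = h.word ++ₛ w ∧
      -- the labels are binary expansions and agree with the standard action on the Cantor set
      (∀ y : ThompsonSchreier.Orbit x,
        Real.ofDigits (ThompsonSchreier.label y) = ((y : unitInterval) : ℝ) ∧
        ∀ g : ThompsonSchreier.Gen, ThompsonSchreier.label (ThompsonSchreier.gen g • y) =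
          ThompsonSchreier.cantorAct g (ThompsonSchreier.label y)) ∧
      -- `Γ_x` is the graph in the figure, with its base vertex and its labels
      (∃ φ : (ThompsonSchreier.figureGraph w).Iso (ThompsonSchreier.Γ x),
        φ.toEquiv (ThompsonSchreier.spineNode 0, h) = ThompsonSchreier.base x ∧
        ∀ v, ThompsonSchreier.label (φ.toEquiv v) = v.2.word ++ₛ v.1.word w) ∧
      (∃ v₀ : ThompsonSchreier.Orbit x, ThompsonSchreier.label v₀ = [1, 0] ++ₛ w ∧
        -- each grey vertex `10u` is the root of a hanging tree, canonically isomorphic to the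
        -- one at `10w`
        (∀ (y : ThompsonSchreier.Orbit x) (u : ThompsonSchreier.Word),
          ThompsonSchreier.label y = [1, 0] ++ₛ u →
          (ThompsonSchreier.hangingTree y).underlying.IsTree ∧
          ∃ ψ : (ThompsonSchreier.hangingTree y).Iso (ThompsonSchreier.hangingTree v₀),
            ψ.toEquiv (ThompsonSchreier.hangingRoot y) = ThompsonSchreier.hangingRoot v₀ ∧
            (∀ ψ' : (ThompsonSchreier.hangingTree y).Iso (ThompsonSchreier.hangingTree v₀),
              ψ'.toEquiv (ThompsonSchreier.hangingRoot y) = ThompsonSchreier.hangingRoot v₀ →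
              ψ' = ψ) ∧
            ∀ z, ∃ p : List (Fin 2), ThompsonSchreier.label z.1 = p ++ₛ u ∧
              ThompsonSchreier.label (ψ.toEquiv z).1 = p ++ₛ w) ∧
        -- the infinite path going up from `10w`, and its turns
        ∃ P : ℕ → ThompsonSchreier.Orbit x, P 0 = v₀ ∧
          (∀ k, ThompsonSchreier.label (P k) = [1, 0] ++ₛ w.drop k) ∧
          (∀ k, (ThompsonSchreier.UpLeft (P k) (P (k + 1)) ↔ w.get k = 0) ∧
            (ThompsonSchreier.UpRight (P k) (P (k + 1)) ↔ w.get k = 1)) ∧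
          ∀ Q : ℕ → ThompsonSchreier.Orbit x, Q 0 = v₀ →
            (∀ k, ThompsonSchreier.UpLeft (Q k) (Q (k + 1)) ∨
              ThompsonSchreier.UpRight (Q k) (Q (k + 1))) → Q = P) ∧
      -- `Γ_x` is the limit of the pointed Schreier graphs of dyadic rationals converging to `x`
      ∀ q : ℕ → unitInterval, (∀ i, ThompsonSchreier.IsDyadic (q i : ℝ)) →
        Filter.Tendsto q Filter.atTop (nhds x) →
        ∀ r : ℕ, ∀ᶠ i in Filter.atTop, ThompsonSchreier.BallsIsomorphic
          (ThompsonSchreier.Γ (q i)) (ThompsonSchreier.base (q i))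
          (ThompsonSchreier.Γ x) (ThompsonSchreier.base x) r := by
  have huniq : ∀ {h k : ThompsonSchreier.Head} {w t : ThompsonSchreier.Word},
      Real.ofDigits (h.word ++ₛ w) = (x : ℝ) → Real.ofDigits (k.word ++ₛ t) = (x : ℝ) →
      h = k ∧ w = t := by
    intro h k w t e e'
    rw [← ThompsonSchreier.head_append_inj, ← ThompsonSchreier.ofDigits_inj (e ▸ hx), e, e']
  refine ⟨?_, fun h w hw => ?_⟩
  · obtain ⟨h, w, e⟩ := ThompsonSchreier.exists_head_append
      (ThompsonSchreier.irrational_ofDigits_label hx (ThompsonSchreier.base x))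
    have e' := (ThompsonSchreier.label_eq_iff hx).1 e
    refine ⟨(h, w), e', fun p hp => ?_⟩
    obtain ⟨h1, h2⟩ := huniq hp e'
    exact Prod.ext h1 h2
  · have hb : ThompsonSchreier.label (ThompsonSchreier.base x) = h.word ++ₛ w :=
      (ThompsonSchreier.label_eq_iff hx).2 hw
    obtain ⟨v₀, hv₀⟩ := ThompsonSchreier.exists_label_eq_append hx hb [1, 0]
    exact ⟨hb, fun y => ⟨ThompsonSchreier.ofDigits_label hx y,
        fun g => ThompsonSchreier.label_gen_smul hx g y⟩,
      ThompsonSchreier.exists_figureGraph_iso hx hb,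
      ⟨v₀, hv₀, fun y u hy => ⟨ThompsonSchreier.hangingTree_isTree hx hy,
        ThompsonSchreier.exists_hangingTree_iso hx hy hv₀⟩,
        ThompsonSchreier.exists_upward_path hx hv₀⟩,
      fun q _ hq r => hq.eventually (ThompsonSchreier.eventually_ballsIsomorphic hx r)⟩
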